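/- **Theorem (PL rate for Muon-MVR2).** Let $n\in\mathbb N$ and $L,\sigma,\mu>0$. There is a constant $K>0$, depending only on $n,L,\sigma,\mu$, such that the following holds. Let $m\ge n$, equip $\mathbb R^{m\times n}$ with the Frobenius inner product and norm $\|\cdot\|_F$, and let $f(\mathbf X)=\mathbb E_{\xi\sim\mathcal D}[f(\mathbf X;\xi)]$, where $f$ and every $f(\cdot;\xi)$ are differentiable on $\mathbb R^{m\times n}$. Suppose that 1. $f$ is bounded below: $f(\mathbf X)\ge f^*$ for all $\mathbf X$, where $f^*\in\mathbb R$; 2. $\|\nabla f(\mathbf Y;\xi)-\nabla f(\mathbf X;\xi)\|_F\le L\|\mathbf Y-\mathbf X\|_F$ for all $\mathbf X,\mathbf Y$ and every $\xi$; 3. $\mathbb E[\nabla f(\mathbf X;\xi)]=\nabla f(\mathbf X)$ and $\mathbb E\|\nabla f(\mathbf X;\xi)-\nabla f(\mathbf X)\|_F^2\le\sigma^2$ for all $\mathbf X$. Let $\xi_1,\xi_2,\dots$ be samples with law $\mathcal D$, each $\xi_{t+1}$ being independent of the history $\mathcal F_t$ up to step $t$ (which contains $\xi_1,\dots,\xi_t$).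 With $\eta_t=t^{-2/3}$, $\beta_t=1-t^{-2/3}$, $\gamma=1$, a deterministic starting matrix $\mathbf X_1$, $\mathbf M_0=0$ and the convention $\nabla f(\mathbf X_0;\cdot)=0$, let, for $t\ge1$, $$\mathbf M_t=\beta_t\mathbf M_{t-1}+(1-\beta_t)\nabla f(\mathbf X_t;\xi_t)+\gamma\beta_t\bigl(\nabla f(\mathbf X_t;\xi_t)-\nabla f(\mathbf X_{t-1};\xi_t)\bigr),\qquad \mathbf X_{t+1}=\mathbf X_t-\eta_t\mathbf O_t,$$ where $\mathbf O_t$ is $\mathcal F_t$-measurable and is an exact orthogonalisation of $\mathbf M_t$: either $\mathbf O_t=\mathbf U\mathbf V^\top$ for a compact singular value decomposition $\mathbf M_t=\mathbf U\mathbf\Sigma\mathbf V^\top$, or $\mathbf O_t\in\arg\min\{\|\mathbf O-\mathbf M_t\|_F:\mathbf O^\top\mathbf O=\mathbf I_n\}$. Suppose finally that $f$ satisfies the $\mu$-PL condition along the iterates: $$\|\nabla f(\mathbf X_t)\|_F^2\ge 2\mu\,(f(\mathbf X_t)-f^*)\quad\text{almost surely, for every } t\ge1$$ (in particular, this holds if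 the inequality holds at every point of $\mathbb R^{m\times n}$). Then $f(\mathbf X_{T+1})$ is integrable for every $T\ge 0$, and there is a $T_0$ such that for all $T\ge T_0$ $$\mathbb E[f(\mathbf X_{T+1})]-f^*\le K\,\frac{(\ln T)^2}{T^{2/3}}.$$ -/

import Mathlib

open MeasureTheory ProbabilityTheory

/-- The space of real `m × n` matrices with the Frobenius inner product and norm, realised as the
Euclidean space over the index pairs `(i, j)`. -/
abbrev FrobSpace (m n : ℕ) : Type := EuclideanSpace ℝ (Fin m × Fin n)

/-- The matrix with entries `X (i, j)`. -/
def FrobSpace.toMat {m n : ℕ} (X : FrobSpace m n) : Matrix (Fin m) (Fin n) ℝ :=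
  Matrix.of fun i j => X (i, j)

/-- The inner product of `FrobSpace m n` is the Frobenius one, `⟨A, B⟩ = tr (Aᵀ B)`. -/
theorem FrobSpace.inner_eq_trace {m n : ℕ} (A B : FrobSpace m n) :
    inner ℝ A B = (A.toMat.transpose * B.toMat).trace := by
  simp only [PiLp.inner_apply, Matrix.trace, Matrix.diag, Matrix.mul_apply, Matrix.transpose_apply,
    FrobSpace.toMat, Matrix.of_apply, Fintype.sum_prod_type]
  rw [Finset.sum_comm]
  refine Finset.sum_congr rfl fun j _ => Finset.sum_congr rfl fun i _ => ?_
  simp [mul_comm]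

/-- `O = U Vᵀ` for a compact singular value decomposition `M = U diag(s) Vᵀ`: the columns of
`U` and of `V` are orthonormal and all `r` singular values in `s` are positive, so `r = rank M`. -/
def IsCompactPolarFactor {m n : ℕ} (M O : FrobSpace m n) : Prop :=
  ∃ (r : ℕ) (U : Matrix (Fin m) (Fin r) ℝ) (s : Fin r → ℝ) (V : Matrix (Fin n) (Fin r) ℝ),
    U.transpose * U = 1 ∧ V.transpose * V = 1 ∧ (∀ k, 0 < s k) ∧
      M.toMat = U * Matrix.diagonal s * V.transpose ∧ O.toMat = U * V.transpose

/-- `O` minimises `‖O - M‖_F` over all `m × n` matrices with `Oᵀ O = I_n`. -/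
def IsNearestOrthonormal {m n : ℕ} (M O : FrobSpace m n) : Prop :=
  O.toMat.transpose * O.toMat = 1 ∧
    ∀ Q : FrobSpace m n, Q.toMat.transpose * Q.toMat = 1 → ‖O - M‖ ≤ ‖Q - M‖

/-- An exact orthogonalised direction for the momentum matrix `M`: either the compact polar factor
`U Vᵀ`, or a minimiser of the orthogonal Procrustes problem. (For `M` of full column rank these
coincide; both are admitted when `M` is rank deficient.) -/
def IsMuonDirection {m n : ℕ} (M O : FrobSpace m n) : Prop :=
  IsCompactPolarFactor M O ∨ IsNearestOrthonormal M O

/-- The objective `f(X) = 𝔼_{ξ ∼ D} f(X; ξ)`, where `F z X` stands for `f(X; z)`. -/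
noncomputable def objective {m n : ℕ} {Z : Type*} [MeasurableSpace Z] (D : Measure Z)
    (F : Z → FrobSpace m n → ℝ) (X : FrobSpace m n) : ℝ :=
  ∫ z, F z X ∂D

/-- The stochastic problem is well posed: every sample loss `f(·; z)` is differentiable,
`f(X; ·)` is measurable and integrable, and the objective is differentiable. -/
structure IsStochasticProblem {m n : ℕ} {Z : Type*} [MeasurableSpace Z] (D : Measure Z)
    (F : Z → FrobSpace m n → ℝ) : Prop where
  sample_differentiable : ∀ z, Differentiable ℝ (F z)
  sample_measurable : ∀ X, Measurable fun z => F z X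
  sample_integrable : ∀ X, Integrable (fun z => F z X) D
  objective_differentiable : Differentiable ℝ (objective D F)

/-- Every sample loss is `L`-smooth:
`‖∇f(Y; z) - ∇f(X; z)‖_F ≤ L ‖Y - X‖_F` for all `z`, `X`, `Y`. -/
def IsSampleSmooth {m n : ℕ} {Z : Type*} (F : Z → FrobSpace m n → ℝ) (L : ℝ) : Prop :=
  ∀ (z : Z) (X Y : FrobSpace m n), ‖gradient (F z) Y - gradient (F z) X‖ ≤ L * ‖Y - X‖

/-- The stochastic gradient is unbiased with variance at most `σ ^ 2` at every point. -/
structure HasUnbiasedBoundedVariance {m n : ℕ} {Z : Type*} [MeasurableSpace Z] (D : Measure Z)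
    (F : Z → FrobSpace m n → ℝ) (σ : ℝ) : Prop where
  grad_integrable : ∀ X, Integrable (fun z => gradient (F z) X) D
  unbiased : ∀ X, ∫ z, gradient (F z) X ∂D = gradient (objective D F) X
  sq_integrable : ∀ X,
    Integrable (fun z => ‖gradient (F z) X - gradient (objective D F) X‖ ^ 2) D
  variance_le : ∀ X, ∫ z, ‖gradient (F z) X - gradient (objective D F) X‖ ^ 2 ∂D ≤ σ ^ 2

/-- The samples `ξ 1, ξ 2, …` have law `D` and are fresh: `𝓕 t` is the history up to step `t`
(it contains `ξ 1, …, ξ t`), and `ξ (t + 1)` is independent of it. In particular the samples are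
independent and identically distributed. The value `ξ 0` is never used. -/
structure IsFreshSampling {Ω Z : Type*} [mΩ : MeasurableSpace Ω] [MeasurableSpace Z]
    (P : Measure Ω) (D : Measure Z) (𝓕 : Filtration ℕ mΩ) (ξ : ℕ → Ω → Z) : Prop where
  adapted : ∀ t, 1 ≤ t → Measurable[𝓕 t] (ξ t)
  law : ∀ t, 1 ≤ t → P.map (ξ t) = D
  indep : ∀ t, Indep (𝓕 t) (MeasurableSpace.comap (ξ (t + 1)) inferInstance) P

/-- A run of Muon with the two-batch variance-reduced momentum (option MVR2), started at the
deterministic matrix `x₁`, with stepsizes `η`, momentum parameters `β` and parameter `γ`.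
`X t`, `M t`, `O t` are the iterate, momentum and direction of step `t ≥ 1`; `M 0 = 0`, and the
gradient at the (non-existing) iterate before `X 1` is `0` by convention. The direction chosen at
step `t` is determined by the history up to step `t`. -/
structure IsMuonMVR2Run {m n : ℕ} {Ω Z : Type*} [mΩ : MeasurableSpace Ω]
    (F : Z → FrobSpace m n → ℝ) (𝓕 : Filtration ℕ mΩ) (ξ : ℕ → Ω → Z)
    (η β : ℕ → ℝ) (γ : ℝ) (x₁ : FrobSpace m n) (X M O : ℕ → Ω → FrobSpace m n) : Prop where
  iterate_one : ∀ ω, X 1 ω = x₁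
  momentum_zero : ∀ ω, M 0 ω = 0
  momentum_one : ∀ ω, M 1 ω = β 1 • M 0 ω + (1 - β 1) • gradient (F (ξ 1 ω)) (X 1 ω)
    + (γ * β 1) • (gradient (F (ξ 1 ω)) (X 1 ω) - 0)
  momentum_succ : ∀ t, 1 ≤ t → ∀ ω, M (t + 1) ω = β (t + 1) • M t ω
    + (1 - β (t + 1)) • gradient (F (ξ (t + 1) ω)) (X (t + 1) ω)
    + (γ * β (t + 1)) •
      (gradient (F (ξ (t + 1) ω)) (X (t + 1) ω) - gradient (F (ξ (t + 1) ω)) (X t ω))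
  direction : ∀ t, 1 ≤ t → ∀ ω, IsMuonDirection (M t ω) (O t ω)
  direction_adapted : ∀ t, 1 ≤ t → Measurable[𝓕 t] (O t)
  iterate_succ : ∀ t, 1 ≤ t → ∀ ω, X (t + 1) ω = X t ω - η t • O t ω

/-!
The proof compares the objective gap `δ t = f (X t) - f*` with the momentum error
`e t = M t - ∇f (X t)`.

*Direction.* An orthogonalised direction has norm at most `√n`, and its pairing with the momentum is
at least `‖M‖ / (n + 1)` (`IsMuonDirection.norm_bounds`). For the Procrustes minimiser this follows
by comparison with one explicit competitor, so no singular value decomposition is needed. With the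
quadratic upper bound for a smooth objective and the PL inequality this gives, almost surely,
`δ (t + 1) ≤ δ t + t^(-2/3) (E t - 4 k √(δ t))`, where `E t` is a multiple of `‖e t‖` plus a multiple
of `t^(-1/3)` (`objective_muon_step_le`).

*Momentum error.* With `γ = 1` the new error is the old one multiplied by `β`, plus a term that is
centred given the past and has second moment of order `t^(-4/3)`. As `1 - β = t^(-2/3)`, it follows
that `𝔼 ‖e t‖² = O(t^(-2/3))` (`IsMuonMVR2Run.lintegral_momentum_error_le`), hence
`𝔼 (E t)² = O(t^(-2/3))`.

*Rate.* Taking expectations in the recursion does not suffice: `𝔼 √δ` is not bounded below by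
`√(𝔼 δ)`. The recursion is instead followed along each path by the potential `(√(δ t) - θ t)₊²`,
whose threshold `θ t` decreases linearly to `T^(-2/3)` at time `T + 1`. The decrease of `θ` is paid
for by the drift `-4 k √δ`, and what the perturbation adds is at most of order
`t^(-2/3) (E t)² / θ (t + 1)` (`posPart_sqrt_sub_sq_step`). Over the second half of the run these
terms have total expectation of order `T^(-2/3) log T`. At the beginning of that half the threshold
is of order `T^(1/3)`, so the potential is there at most of order `T^(-2/3) (δ t)²`; the second moment
of `δ t` is `O((log T)²)` by Minkowski's inequality (`sqrt_recursion_second_moment`). Both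
contributions together give `(log T)² / T^(2/3)` (`sqrt_recursion_rate`); the initial gap only
affects how large `T` has to be.
-/

/-! ### Orthogonalised directions -/

theorem FrobSpace.norm_sq_eq_trace {m n : ℕ} (A : FrobSpace m n) :
    ‖A‖ ^ 2 = (A.toMat.transpose * A.toMat).trace := by
  rw [← real_inner_self_eq_norm_sq, FrobSpace.inner_eq_trace]

theorem FrobSpace.norm_sq_of_orthonormal {m n : ℕ} {A : FrobSpace m n}
    (h : A.toMat.transpose * A.toMat = 1) : ‖A‖ ^ 2 = n := by
  rw [FrobSpace.norm_sq_eq_trace, h, Matrix.trace_one, Fintype.card_fin]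

/-- For `M = U diag(s) Vᵀ` and `O = U Vᵀ` the pairing `⟪M, O⟫` is the nuclear norm `∑ s`, which
dominates the Frobenius norm `(∑ s²)^(1/2)`. -/
theorem IsCompactPolarFactor.norm_bounds {m n : ℕ} {M O : FrobSpace m n}
    (h : IsCompactPolarFactor M O) : ‖O‖ ^ 2 ≤ n ∧ ‖M‖ ≤ inner ℝ M O := by
  obtain ⟨r, U, s, V, hU, hV, hs, hM, hO⟩ := h
  have hr : r ≤ n := by
    have h1 : (1 : Matrix (Fin r) (Fin r) ℝ).rank = r := by
      rw [Matrix.rank_one, Fintype.card_fin]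
    have h2 := Matrix.rank_mul_le_right V.transpose V
    rw [hV, h1] at h2
    exact h2.trans V.rank_le_height
  have hOO : ‖O‖ ^ 2 = r := by
    rw [FrobSpace.norm_sq_eq_trace, hO, Matrix.transpose_mul, Matrix.transpose_transpose,
      Matrix.mul_assoc, ← Matrix.mul_assoc U.transpose, hU, Matrix.one_mul, Matrix.trace_mul_comm,
      hV, Matrix.trace_one, Fintype.card_fin]
  have hMO : inner ℝ M O = ∑ k, s k := by
    rw [FrobSpace.inner_eq_trace, hO, hM, Matrix.transpose_mul, Matrix.transpose_mul,
      Matrix.transpose_transpose, Matrix.diagonal_transpose, Matrix.mul_assoc, Matrix.mul_assoc,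
      ← Matrix.mul_assoc U.transpose, hU, Matrix.one_mul, Matrix.trace_mul_comm,
      Matrix.mul_assoc, hV, Matrix.mul_one, Matrix.trace_diagonal]
  have hMM : ‖M‖ ^ 2 = ∑ k, s k ^ 2 := by
    rw [FrobSpace.norm_sq_eq_trace, hM, Matrix.transpose_mul, Matrix.transpose_mul,
      Matrix.transpose_transpose, Matrix.diagonal_transpose, Matrix.mul_assoc, Matrix.mul_assoc,
      Matrix.mul_assoc, ← Matrix.mul_assoc U.transpose, hU, Matrix.one_mul, Matrix.trace_mul_comm,
      Matrix.mul_assoc, Matrix.mul_assoc, hV, Matrix.mul_one, Matrix.diagonal_mul_diagonal,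
      Matrix.trace_diagonal]
    exact Finset.sum_congr rfl fun k _ => (sq _).symm
  refine ⟨by rw [hOO]; exact_mod_cast hr, ?_⟩
  rw [hMO]
  refine abs_le_of_sq_le_sq' ?_ (Finset.sum_nonneg fun k _ => (hs k).le) |>.2
  rw [hMM]
  exact Finset.sum_sq_le_sq_sum_of_nonneg fun k _ => (hs k).le

/-- The `k`-th column of a matrix, as a vector of the Euclidean space. -/
noncomputable def FrobSpace.col {m n : ℕ} (A : FrobSpace m n) (k : Fin n) :
    EuclideanSpace ℝ (Fin m) :=
  WithLp.toLp 2 fun i => A (i, k)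

theorem FrobSpace.inner_eq_sum_col {m n : ℕ} (A B : FrobSpace m n) :
    inner ℝ A B = ∑ k, inner ℝ (A.col k) (B.col k) := by
  simp only [PiLp.inner_apply, Fintype.sum_prod_type, FrobSpace.col]
  exact Finset.sum_comm

theorem FrobSpace.norm_le_sum_col {m n : ℕ} (A : FrobSpace m n) :
    ‖A‖ ≤ ∑ k, ‖A.col k‖ := by
  refine abs_le_of_sq_le_sq' ?_ (Finset.sum_nonneg fun k _ => norm_nonneg _) |>.2
  rw [← real_inner_self_eq_norm_sq, FrobSpace.inner_eq_sum_col]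
  simp only [real_inner_self_eq_norm_sq]
  exact Finset.sum_sq_le_sq_sum_of_nonneg fun k _ => norm_nonneg _

theorem FrobSpace.transpose_mul_apply {m n : ℕ} (A B : FrobSpace m n) (k l : Fin n) :
    (A.toMat.transpose * B.toMat) k l = inner ℝ (A.col k) (B.col l) := by
  simp [Matrix.mul_apply, FrobSpace.toMat, FrobSpace.col, PiLp.inner_apply, mul_comm]

/-- A test matrix for the Procrustes problem: its columns are orthonormal, one of them is the
normalised longest column of `M`, and the signs of the others make their pairing with the
corresponding column of `M` nonnegative. -/
theorem exists_orthonormal_norm_le_inner {m n : ℕ} (hmn : n ≤ m) (M : FrobSpace m n)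
    (hM : M ≠ 0) : ∃ Q : FrobSpace m n, Q.toMat.transpose * Q.toMat = 1 ∧
      ‖M‖ ≤ (n + 1) * inner ℝ M Q := by
  have hn : Nonempty (Fin n) := by
    by_contra hn
    rw [not_nonempty_iff] at hn
    exact hM (by ext ⟨i, k⟩; exact isEmptyElim k)
  obtain ⟨j, hj⟩ := Finite.exists_max fun k => ‖M.col k‖
  have hsum : ‖M‖ ≤ n * ‖M.col j‖ := by
    refine (FrobSpace.norm_le_sum_col M).trans ((Finset.sum_le_sum fun k _ => hj k).trans ?_)
    simp
  have hpos : 0 < ‖M.col j‖ := by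
    rcases (norm_nonneg (M.col j)).eq_or_lt with h | h
    · rw [← h, mul_zero] at hsum
      exact absurd (norm_le_zero_iff.1 hsum) hM
    · exact h
  have hu : Orthonormal ℝ (({Fin.castLE hmn j} : Set (Fin m)).domRestrict
      fun _ => (‖M.col j‖⁻¹ : ℝ) • M.col j) := by
    refine ⟨fun i => ?_, fun i i' hii => absurd (Subsingleton.elim i i') hii⟩
    simp [Set.domRestrict_apply, norm_smul, hpos.ne']
  obtain ⟨b, hb⟩ := hu.exists_orthonormalBasis_extension_of_card_eq
    (by simp : Module.finrank ℝ (EuclideanSpace ℝ (Fin m)) = Fintype.card (Fin m))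
  have hbj : b (Fin.castLE hmn j) = (‖M.col j‖⁻¹ : ℝ) • M.col j := hb _ rfl
  set ε : Fin n → ℝ := fun k =>
    if 0 ≤ inner ℝ (M.col k) (b (Fin.castLE hmn k)) then 1 else -1 with hε
  have hε2 : ∀ k, ε k * ε k = 1 := fun k => by
    simp only [hε]; split_ifs <;> norm_num
  have hεp : ∀ k, 0 ≤ ε k * inner ℝ (M.col k) (b (Fin.castLE hmn k)) := fun k => by
    simp only [hε]; split_ifs with h <;> linarith
  let Q : FrobSpace m n := WithLp.toLp 2 fun p => (ε p.2 • b (Fin.castLE hmn p.2)) p.1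
  have hQ : ∀ k, Q.col k = ε k • b (Fin.castLE hmn k) := fun k => by
    ext i; simp [Q, FrobSpace.col]
  refine ⟨Q, ?_, ?_⟩
  · ext k l
    rw [FrobSpace.transpose_mul_apply, hQ, hQ, inner_smul_left, inner_smul_right,
      orthonormal_iff_ite.1 b.orthonormal, Matrix.one_apply]
    by_cases hkl : k = l
    · subst hkl; simp [hε2]
    · simp [hkl]
  · have hinner : ‖M.col j‖ ≤ inner ℝ M Q := by
      rw [FrobSpace.inner_eq_sum_col]
      simp only [hQ, inner_smul_right]
      refine le_trans ?_ (Finset.single_le_sum (fun k _ => hεp k) (Finset.mem_univ j))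
      have h1 : inner ℝ (M.col j) (b (Fin.castLE hmn j)) = ‖M.col j‖ := by
        rw [hbj, inner_smul_right, real_inner_self_eq_norm_sq]
        field_simp
      have h2 : ε j = 1 := by simp only [hε]; rw [h1, if_pos hpos.le]
      rw [h2, h1, one_mul]
    have hn0 : (0 : ℝ) ≤ n := n.cast_nonneg
    nlinarith

theorem IsNearestOrthonormal.norm_bounds {m n : ℕ} (hmn : n ≤ m) {M O : FrobSpace m n}
    (h : IsNearestOrthonormal M O) : ‖O‖ ^ 2 ≤ n ∧ ‖M‖ ≤ (n + 1) * inner ℝ M O := by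
  refine ⟨(FrobSpace.norm_sq_of_orthonormal h.1).le, ?_⟩
  rcases eq_or_ne M 0 with rfl | hM
  · simp
  obtain ⟨Q, hQ, hMQ⟩ := exists_orthonormal_norm_le_inner hmn M hM
  have h1 : ‖O - M‖ ^ 2 ≤ ‖Q - M‖ ^ 2 := by gcongr; exact h.2 Q hQ
  rw [norm_sub_sq_real, norm_sub_sq_real, FrobSpace.norm_sq_of_orthonormal h.1,
    FrobSpace.norm_sq_of_orthonormal hQ, real_inner_comm, real_inner_comm M Q] at h1
  have h2 : inner ℝ M Q ≤ inner ℝ M O := by linarith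
  exact hMQ.trans (by gcongr)

/-- The two facts about the orthogonalisation that the analysis uses: the direction is bounded, and
its pairing with the momentum controls the Frobenius norm of the momentum. -/
theorem IsMuonDirection.norm_bounds {m n : ℕ} (hmn : n ≤ m) {M O : FrobSpace m n}
    (h : IsMuonDirection M O) : ‖O‖ ^ 2 ≤ n ∧ ‖M‖ ≤ (n + 1) * inner ℝ M O := by
  rcases h with h | h
  · obtain ⟨h1, h2⟩ := h.norm_bounds
    refine ⟨h1, ?_⟩
    have hn0 : (0 : ℝ) ≤ n := n.cast_nonneg
    nlinarith [norm_nonneg M]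
  · exact h.norm_bounds hmn

/-! ### Regularity of the stochastic gradient and of the objective -/

section Regularity

variable {m n : ℕ} {Z : Type*} [MeasurableSpace Z] {D : Measure Z} {F : Z → FrobSpace m n → ℝ}
  {L σ : ℝ}

/-- Each coordinate of the gradient is a limit of difference quotients. -/
theorem IsStochasticProblem.measurable_gradient (hF : IsStochasticProblem D F)
    (X : FrobSpace m n) : Measurable fun z => gradient (F z) X := by
  have hcoord : ∀ p, Measurable fun z => gradient (F z) X p := by
    intro p
    set v : FrobSpace m n := EuclideanSpace.single p 1
    refine measurable_of_tendsto_metrizable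
      (f := fun (k : ℕ) z => (k : ℝ) • (F z (X + (k : ℝ)⁻¹ • v) - F z X)) (fun k => ?_) ?_
    · exact ((hF.sample_measurable (X + (k : ℝ)⁻¹ • v)).sub (hF.sample_measurable X)).const_smul
        (k : ℝ)
    · rw [tendsto_pi_nhds]
      intro z
      have h := (hF.sample_differentiable z X).hasFDerivAt.lim_real v
      have h2 := h.comp tendsto_natCast_atTop_atTop
      have h3 : fderiv ℝ (F z) X v = gradient (F z) X p := by
        rw [← toDual_gradient, InnerProductSpace.toDual_apply_apply,
          EuclideanSpace.inner_single_right]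
        simp
      rw [← h3]
      exact h2
  exact (WithLp.measurable_toLp 2 _).comp (measurable_pi_lambda _ hcoord)

theorem IsSampleSmooth.continuous_gradient {Z : Type*} {F : Z → FrobSpace m n → ℝ}
    (hL : IsSampleSmooth F L) (z : Z) :
    Continuous (gradient (F z)) := by
  refine (LipschitzWith.of_dist_le_mul (K := L.toNNReal) fun X Y => ?_).continuous
  rw [dist_eq_norm, dist_eq_norm, Real.coe_toNNReal']
  exact (hL z Y X).trans (mul_le_mul_of_nonneg_right (le_max_left _ _) (norm_nonneg _))

theorem IsStochasticProblem.measurable_gradient_uncurry (hF : IsStochasticProblem D F)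
    (hL : IsSampleSmooth F L) :
    Measurable fun p : FrobSpace m n × Z => gradient (F p.2) p.1 :=
  measurable_uncurry_of_continuous_of_measurable (u := fun X z => gradient (F z) X)
    (fun z => hL.continuous_gradient z) fun X => hF.measurable_gradient X

theorem HasUnbiasedBoundedVariance.norm_gradient_sub_le [IsProbabilityMeasure D]
    (hσ : HasUnbiasedBoundedVariance D F σ) (hL : IsSampleSmooth F L) (X Y : FrobSpace m n) :
    ‖gradient (objective D F) Y - gradient (objective D F) X‖ ≤ L * ‖Y - X‖ := by
  rw [← hσ.unbiased, ← hσ.unbiased, ← integral_sub (hσ.grad_integrable Y) (hσ.grad_integrable X)]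
  have h := norm_integral_le_of_norm_le_const (μ := D) (C := L * ‖Y - X‖)
    (f := fun z => gradient (F z) Y - gradient (F z) X) (ae_of_all _ fun z => hL z X Y)
  simpa using h

theorem continuous_gradient_objective [IsProbabilityMeasure D]
    (hσ : HasUnbiasedBoundedVariance D F σ) (hL : IsSampleSmooth F L) :
    Continuous (gradient (objective D F)) := by
  refine (LipschitzWith.of_dist_le_mul (K := L.toNNReal) fun X Y => ?_).continuous
  rw [dist_eq_norm, dist_eq_norm, Real.coe_toNNReal']
  exact (hσ.norm_gradient_sub_le hL Y X).trans
    (mul_le_mul_of_nonneg_right (le_max_left _ _) (norm_nonneg _))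

/-- The quadratic upper bound for a function with Lipschitz gradient. The sharp constant `L / 2` is
not needed. -/
theorem le_add_inner_gradient_add_sq {E : Type*} [NormedAddCommGroup E] [InnerProductSpace ℝ E]
    [CompleteSpace E] {f : E → ℝ} (hf : Differentiable ℝ f) (hL0 : 0 ≤ L)
    (hL : ∀ x y, ‖gradient f y - gradient f x‖ ≤ L * ‖y - x‖) (x y : E) :
    f y ≤ f x + inner ℝ (gradient f x) (y - x) + L * ‖y - x‖ ^ 2 := by
  have hb : ∀ z ∈ segment ℝ x y, ‖fderiv ℝ f z - fderiv ℝ f x‖ ≤ L * ‖y - x‖ := by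
    intro z hz
    rw [← toDual_gradient, ← toDual_gradient, ← map_sub, LinearIsometryEquiv.norm_map]
    refine (hL x z).trans (mul_le_mul_of_nonneg_left ?_ hL0)
    rw [segment_eq_image'] at hz
    obtain ⟨t, ht, rfl⟩ := hz
    rw [add_sub_cancel_left, norm_smul, Real.norm_of_nonneg ht.1]
    exact mul_le_of_le_one_left (norm_nonneg _) ht.2
  have h := (convex_segment x y).norm_image_sub_le_of_norm_fderiv_le' (fun z _ => hf z) hb
    (left_mem_segment ℝ x y) (right_mem_segment ℝ x y)
  rw [← toDual_gradient, InnerProductSpace.toDual_apply_apply] at h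
  have h2 := (abs_le.1 h).2
  nlinarith

end Regularity

/-! ### The square-root recursion -/

/-- One step of the potential `(√x - θ)₊²`. While `√x` dominates `E`, the recursion lowers `√x` by at
least `k η`, which matches the decrease of the threshold from `θ` to `θ'`. Otherwise `E` is at least
of the order of `θ'`, so that the increase, of order `η E`, is at most of order `η E² / θ'`. -/
theorem posPart_sqrt_sub_sq_step {k η x y E θ θ' : ℝ} (hk : 0 < k) (hη : 0 ≤ η) (hx : 0 ≤ x)
    (hy : 0 ≤ y) (hE : 0 ≤ E) (hθ' : 0 < θ') (hθ : θ ≤ θ' + k * η) (hηθ : η ≤ 2 * θ')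
    (hstep : y ≤ x + η * (E - 4 * k * √x)) :
    (max (√y - θ') 0) ^ 2 ≤
      (max (√x - θ) 0) ^ 2 + 2 / min k (1 / 4) * (η * (E ^ 2 / θ')) := by
  obtain ⟨u, hu⟩ : ∃ u, u = √x := ⟨_, rfl⟩
  obtain ⟨s, hs⟩ : ∃ s, s = √y := ⟨_, rfl⟩
  have hu0 : 0 ≤ u := hu ▸ Real.sqrt_nonneg x
  have hs0 : 0 ≤ s := hs ▸ Real.sqrt_nonneg y
  have hux : u ^ 2 = x := by rw [hu, Real.sq_sqrt hx]
  have hsy : s ^ 2 = y := by rw [hs, Real.sq_sqrt hy]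
  rw [← hu] at hstep
  rw [← hu, ← hs]
  have hc : 0 < min k (1 / 4) := lt_min hk (by norm_num)
  have hlast : 0 ≤ 2 / min k (1 / 4) * (η * (E ^ 2 / θ')) := by positivity
  rcases le_or_gt s θ' with hsθ | hsθ
  · rw [max_eq_right (by linarith : s - θ' ≤ 0)]
    nlinarith [sq_nonneg (max (u - θ) 0)]
  rw [max_eq_left (by linarith : 0 ≤ s - θ')]
  have hkη : 0 ≤ k * η := by positivity
  -- Either `E` uses at most half of the drift `4 k u`, or `u` is at most of the order of `E`.
  rcases le_or_gt E (2 * k * u) with hEu | hEu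
  · have h1 : s ^ 2 ≤ u * (u - 2 * (k * η)) := by
      have := mul_le_mul_of_nonneg_left hEu hη
      nlinarith
    have h2 : 0 < u := by
      rcases hu0.eq_or_lt with h | h
      · rw [← h, zero_mul] at h1; nlinarith
      · exact h
    have h3 : 2 * (k * η) < u := by
      by_contra hcon
      nlinarith
    have h4 : s ≤ u - k * η := by
      refine abs_le_of_sq_le_sq' ?_ (by linarith) |>.2
      nlinarith [sq_nonneg (k * η)]
    have h5 : s - θ' ≤ max (u - θ) 0 := le_max_of_le_left (by linarith)
    nlinarith
  · have hηE : 0 ≤ η * E := by positivity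
    have hyE : s ^ 2 ≤ u ^ 2 + η * E := by
      have : 0 ≤ η * (k * u) := by positivity
      nlinarith
    have hmono : (s - θ') ^ 2 ≤ (max (u - θ') 0) ^ 2 + η * E := by
      rcases le_total u θ' with h | h
      · rw [max_eq_right (by linarith : u - θ' ≤ 0)]
        nlinarith
      · rw [max_eq_left (by linarith : 0 ≤ u - θ')]
        rcases le_total s u with h' | h'
        · have : (s - θ') ^ 2 ≤ (u - θ') ^ 2 := by gcongr
          linarith
        · have := mul_nonneg hθ'.le (sub_nonneg.2 h')
          linarith
    have hshift : (max (u - θ') 0) ^ 2 ≤ (max (u - θ) 0) ^ 2 + η * E := by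
      rcases le_total u θ' with h | h
      · rw [max_eq_right (by linarith : u - θ' ≤ 0)]
        nlinarith [sq_nonneg (max (u - θ) 0)]
      · rw [max_eq_left (by linarith : 0 ≤ u - θ')]
        have h1 : 2 * (k * η) * u ≤ η * E := by
          have := mul_le_mul_of_nonneg_left hEu.le hη
          linarith
        have h2 : (u - θ') - k * η ≤ max (u - θ) 0 := le_max_of_le_left (by linarith)
        have h3 : 0 ≤ max (u - θ) 0 := le_max_right _ _
        rcases le_total (u - θ') (k * η) with h' | h'
        · have := mul_le_mul h' h (by linarith) hkη
          nlinarith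
        · have : (u - θ' - k * η) ^ 2 ≤ (max (u - θ) 0) ^ 2 := by gcongr
          have := mul_nonneg hkη hθ'.le
          nlinarith
    have hlow : min k (1 / 4) * θ' ≤ E := by
      by_contra hcon
      push Not at hcon
      have h1 : min k (1 / 4) ≤ k := min_le_left _ _
      have h2 : min k (1 / 4) ≤ 1 / 4 := min_le_right _ _
      have h3 : 2 * u ≤ θ' := by
        have h4 := mul_le_mul_of_nonneg_right h1 hθ'.le
        have : k * (2 * u) < k * θ' := by linarith
        exact (lt_of_mul_lt_mul_left this hk.le).le
      have h4 : E ≤ θ' / 4 := by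
        have := mul_le_mul_of_nonneg_right h2 hθ'.le
        linarith
      have h5 : η * E ≤ 2 * θ' * (θ' / 4) := mul_le_mul hηθ h4 hE (by linarith)
      have h6 : (2 * u) ^ 2 ≤ θ' ^ 2 := by gcongr
      have h7 : θ' ^ 2 < s ^ 2 := by gcongr
      have h8 := sq_pos_of_pos hθ'
      linarith
    have hfin : 2 * (η * E) ≤ 2 / min k (1 / 4) * (η * (E ^ 2 / θ')) := by
      have h1 : E ≤ E * (E / (min k (1 / 4) * θ')) := by
        refine le_mul_of_one_le_right hE ?_
        rwa [one_le_div (by positivity)]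
      calc 2 * (η * E) ≤ 2 * (η * (E * (E / (min k (1 / 4) * θ')))) := by gcongr
        _ = 2 / min k (1 / 4) * (η * (E ^ 2 / θ')) := by field_simp
    linarith

theorem rpow_neg_two_thirds_le {s t : ℝ} (ht : 0 < t) (hst : t ≤ 2 * s) :
    s ^ (-(2 / 3) : ℝ) ≤ 2 * t ^ (-(2 / 3) : ℝ) := by
  have h1 : s ^ (-(2 / 3) : ℝ) ≤ (t / 2) ^ (-(2 / 3) : ℝ) :=
    Real.rpow_le_rpow_of_nonpos (by positivity) (by linarith) (by norm_num)
  refine h1.trans ?_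
  rw [div_eq_mul_inv, Real.mul_rpow ht.le (by norm_num), mul_comm]
  refine mul_le_mul_of_nonneg_right ?_ (by positivity)
  rw [Real.inv_rpow (by norm_num), ← Real.rpow_neg (by norm_num), neg_neg]
  calc (2 : ℝ) ^ (2 / 3 : ℝ) ≤ 2 ^ (1 : ℝ) :=
        Real.rpow_le_rpow_of_exponent_le (by norm_num) (by norm_num)
    _ = 2 := Real.rpow_one 2

/-- The potential estimate summed over the second half `⌈T/2⌉ ≤ t ≤ T` of the run, with the
threshold `θ t = T^(-2/3) (1 + k (T + 1 - t))`. -/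
theorem sqrt_recursion_half_run {k : ℝ} (hk : 0 < k) {δ E : ℕ → ℝ} (hδ : ∀ t, 1 ≤ t → 0 ≤ δ t)
    (hE : ∀ t, 1 ≤ t → 0 ≤ E t)
    (hstep : ∀ t, 1 ≤ t →
      δ (t + 1) ≤ δ t + (t : ℝ) ^ (-(2 / 3) : ℝ) * (E t - 4 * k * √(δ t)))
    {T : ℕ} (hT : 1 ≤ T) :
    δ (T + 1) ≤ 2 * ((T : ℝ) ^ (-(2 / 3) : ℝ)) ^ 2
      + 8 / k ^ 2 * (T : ℝ) ^ (-(2 / 3) : ℝ) * δ ((T + 1) / 2) ^ 2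
      + 8 / min k (1 / 4) *
        ∑ t ∈ Finset.Ico ((T + 1) / 2) (T + 1), E t ^ 2 / (1 + k * ((T : ℝ) - t)) := by
  obtain ⟨p, hp⟩ : ∃ p, p = (T : ℝ) ^ (-(2 / 3) : ℝ) := ⟨_, rfl⟩
  have hT0 : (0 : ℝ) < T := by exact_mod_cast hT
  have hp0 : 0 < p := hp ▸ Real.rpow_pos_of_pos hT0 _
  rw [← hp]
  set θ : ℕ → ℝ := fun t => p * (1 + k * ((T : ℝ) + 1 - t)) with hθ
  set c := min k (1 / 4) with hc
  have hc0 : 0 < c := lt_min hk (by norm_num)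
  have hacc : ∀ s, (T + 1) / 2 ≤ s → s ≤ T + 1 → (max (√(δ s) - θ s) 0) ^ 2 ≤
      (max (√(δ ((T + 1) / 2)) - θ ((T + 1) / 2)) 0) ^ 2
        + 4 / c * ∑ t ∈ Finset.Ico ((T + 1) / 2) s, E t ^ 2 / (1 + k * ((T : ℝ) - t)) := by
    refine Nat.le_induction (fun _ => by simp) fun t ht ih htT => ?_
    have ht1 : 1 ≤ t := by omega
    have htT' : (t : ℝ) ≤ T := by exact_mod_cast (by omega : t ≤ T)
    have ht0 : (0 : ℝ) < t := by exact_mod_cast ht1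
    have hη0 : 0 < (t : ℝ) ^ (-(2 / 3) : ℝ) := Real.rpow_pos_of_pos ht0 _
    have hη1 : p ≤ (t : ℝ) ^ (-(2 / 3) : ℝ) := by
      rw [hp]; exact Real.rpow_le_rpow_of_nonpos ht0 htT' (by norm_num)
    have hη2 : (t : ℝ) ^ (-(2 / 3) : ℝ) ≤ 2 * p := by
      rw [hp]
      refine rpow_neg_two_thirds_le hT0 ?_
      exact_mod_cast (by omega : T ≤ 2 * t)
    have hw : 0 ≤ k * ((T : ℝ) - t) := mul_nonneg hk.le (by linarith)
    have hθ1 : θ (t + 1) = p * (1 + k * ((T : ℝ) - t)) := by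
      simp only [hθ]; push_cast; ring
    have hθ2 : p ≤ θ (t + 1) := by rw [hθ1]; nlinarith
    have h := posPart_sqrt_sub_sq_step (E := E t) (θ := θ t) (θ' := θ (t + 1)) hk hη0.le
      (hδ t ht1) (hδ (t + 1) (by omega)) (hE t ht1) (by linarith)
      (by rw [hθ1]; simp only [hθ]; nlinarith) (by linarith) (hstep t ht1)
    have h2 : 2 / c * ((t : ℝ) ^ (-(2 / 3) : ℝ) * (E t ^ 2 / θ (t + 1))) ≤
        4 / c * (E t ^ 2 / (1 + k * ((T : ℝ) - t))) := by
      have h3 : (0 : ℝ) < 1 + k * ((T : ℝ) - t) := by linarith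
      calc 2 / c * ((t : ℝ) ^ (-(2 / 3) : ℝ) * (E t ^ 2 / θ (t + 1)))
          ≤ 2 / c * (2 * p * (E t ^ 2 / θ (t + 1))) := by
            have : 0 ≤ E t ^ 2 / θ (t + 1) := div_nonneg (sq_nonneg _) (by linarith)
            gcongr
        _ = 4 / c * (E t ^ 2 / (1 + k * ((T : ℝ) - t))) := by
            rw [hθ1]; field_simp; ring
    rw [Finset.sum_Ico_succ_top ht, mul_add]
    have := ih (by omega)
    linarith
  have hend := hacc (T + 1) (by omega) le_rfl
  have hθend : θ (T + 1) = p := by simp [hθ]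
  rw [hθend] at hend
  -- The final value is recovered from the potential at threshold `p`.
  have hfin : δ (T + 1) ≤ 2 * p ^ 2 + 2 * (max (√(δ (T + 1)) - p) 0) ^ 2 := by
    have h1 : √(δ (T + 1)) ≤ p + max (√(δ (T + 1)) - p) 0 := by
      linarith [le_max_left (√(δ (T + 1)) - p) 0]
    have h2 : √(δ (T + 1)) ^ 2 ≤ (p + max (√(δ (T + 1)) - p) 0) ^ 2 := by gcongr
    rw [Real.sq_sqrt (hδ _ (by omega))] at h2
    nlinarith [sq_nonneg (p - max (√(δ (T + 1)) - p) 0)]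
  -- At the start of the half run the threshold is of order `T^(1/3)`.
  have hstart : (max (√(δ ((T + 1) / 2)) - θ ((T + 1) / 2)) 0) ^ 2 ≤
      4 / k ^ 2 * p * δ ((T + 1) / 2) ^ 2 := by
    set x := δ ((T + 1) / 2)
    have hx0 : 0 ≤ x := hδ _ (by omega)
    have ht : (((T + 1) / 2 : ℕ) : ℝ) ≤ ((T : ℝ) + 1) / 2 := by
      have := @Nat.cast_div_le ℝ _ _ _ (T + 1) 2
      push_cast at this ⊢; linarith
    have hθs : p * k * T / 2 ≤ θ ((T + 1) / 2) := by
      have : (T : ℝ) / 2 ≤ T + 1 - (((T + 1) / 2 : ℕ) : ℝ) := by linarith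
      have h2 : k * (T / 2) ≤ k * ((T : ℝ) + 1 - (((T + 1) / 2 : ℕ) : ℝ)) := by gcongr
      simp only [hθ]
      nlinarith
    have hθs0 : 0 < p * k * T / 2 := by positivity
    have hpT : p ^ 3 * T ^ 2 = 1 := by
      rw [hp, ← Real.rpow_natCast, ← Real.rpow_natCast (T : ℝ), ← Real.rpow_mul hT0.le,
        ← Real.rpow_add hT0]
      norm_num
    have h1 : max (√x - θ ((T + 1) / 2)) 0 ≤ x / (p * k * T / 2) := by
      refine max_le ?_ (by positivity)
      rw [le_div_iff₀ hθs0]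
      have h2 := Real.sq_sqrt hx0
      have h3 := Real.sqrt_nonneg x
      nlinarith [sq_nonneg (√x - p * k * T / 2)]
    calc (max (√x - θ ((T + 1) / 2)) 0) ^ 2 ≤ (x / (p * k * T / 2)) ^ 2 := by
          gcongr
      _ = 4 / k ^ 2 * (p ^ 3 * T ^ 2) * x ^ 2 / (p ^ 2 * T ^ 2) := by
          rw [hpT]; field_simp; ring
      _ = 4 / k ^ 2 * p * x ^ 2 := by field_simp
  set S := ∑ t ∈ Finset.Ico ((T + 1) / 2) (T + 1), E t ^ 2 / (1 + k * ((T : ℝ) - t))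
  have e1 : 8 / k ^ 2 * p * δ ((T + 1) / 2) ^ 2 = 2 * (4 / k ^ 2 * p * δ ((T + 1) / 2) ^ 2) := by
    ring
  have e2 : 8 / c * S = 2 * (4 / c * S) := by ring
  rw [e1, e2]
  linarith

theorem sum_Ico_one_div_le (t : ℕ) :
    ∑ s ∈ Finset.Ico 1 (t + 1), (1 : ℝ) / s ≤ 1 + Real.log t := by
  have h := harmonic_le_one_add_log t
  rw [harmonic_eq_sum_Icc] at h
  push_cast at h
  rw [Finset.Ico_add_one_right_eq_Icc]
  simpa only [one_div] using h

/-- A logarithmic bound for the weights `1 / (1 + k (T - t))` produced by the potential. -/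
theorem sum_Ico_weights_le {k : ℝ} (hk : 0 < k) (s T : ℕ) :
    ∑ t ∈ Finset.Ico s (T + 1), 1 / (1 + k * ((T : ℝ) - t)) ≤
      (1 + Real.log (T + 1)) / min 1 k := by
  have hc : 0 < min 1 k := lt_min one_pos hk
  have hterm : ∀ t ∈ Finset.range (T + 1),
      0 ≤ 1 / (1 + k * ((T : ℝ) - t)) ∧
        1 / (1 + k * ((T : ℝ) - t)) ≤ (1 / ((T - t + 1 : ℕ) : ℝ)) / min 1 k := by
    intro t ht
    have htT : t ≤ T := by rw [Finset.mem_range] at ht; omega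
    have h0 : (0 : ℝ) ≤ (T : ℝ) - t := sub_nonneg.2 (by exact_mod_cast htT)
    have h1 : 0 ≤ k * ((T : ℝ) - t) := mul_nonneg hk.le h0
    refine ⟨by positivity, ?_⟩
    rw [div_div]
    refine one_div_le_one_div_of_le (by positivity) ?_
    push_cast [htT]
    have h2 := mul_le_mul_of_nonneg_right (min_le_right 1 k) h0
    have h3 := min_le_left 1 k
    linarith
  calc ∑ t ∈ Finset.Ico s (T + 1), 1 / (1 + k * ((T : ℝ) - t))
      ≤ ∑ t ∈ Finset.range (T + 1), 1 / (1 + k * ((T : ℝ) - t)) := by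
        refine Finset.sum_le_sum_of_subset_of_nonneg ?_ fun t ht _ => (hterm t ht).1
        rw [Finset.range_eq_Ico]
        exact Finset.Ico_subset_Ico_left (Nat.zero_le s)
    _ ≤ ∑ t ∈ Finset.range (T + 1), (1 / ((T - t + 1 : ℕ) : ℝ)) / min 1 k :=
        Finset.sum_le_sum fun t ht => (hterm t ht).2
    _ = (∑ j ∈ Finset.range (T + 1), 1 / ((j + 1 : ℕ) : ℝ)) / min 1 k := by
        rw [← Finset.sum_div, ← Finset.sum_range_reflect]
        congr 1
        refine Finset.sum_congr rfl fun t ht => ?_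
        rw [Finset.mem_range] at ht
        congr 3
        omega
    _ ≤ (1 + Real.log (T + 1)) / min 1 k := by
        have h := sum_Ico_one_div_le (T + 1)
        rw [Finset.sum_Ico_eq_sum_range] at h
        push_cast at h ⊢
        simp only [add_comm (1 : ℝ)] at h
        gcongr
        simpa only [add_comm (1 : ℝ)] using h

section SquareRootProcess

variable {Ω : Type*} [MeasurableSpace Ω] {P : Measure Ω}

/-- Minkowski's inequality for a nonnegative combination, in terms of second moments. -/
theorem integral_add_mul_sq_le {x y : Ω → ℝ} {η A G : ℝ} (hη : 0 ≤ η) (hA : 0 < A) (hG : 0 < G)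
    (hxm : AEStronglyMeasurable x P) (hym : AEStronglyMeasurable y P)
    (hx : Integrable (fun ω => x ω ^ 2) P) (hy : Integrable (fun ω => y ω ^ 2) P)
    (hxA : ∫ ω, x ω ^ 2 ∂P ≤ A ^ 2) (hyG : ∫ ω, y ω ^ 2 ∂P ≤ G ^ 2) :
    Integrable (fun ω => (x ω + η * y ω) ^ 2) P ∧
      ∫ ω, (x ω + η * y ω) ^ 2 ∂P ≤ (A + η * G) ^ 2 := by
  have hpt : ∀ ω, (x ω + η * y ω) ^ 2 ≤
      (1 + η * (G / A)) * x ω ^ 2 + (η ^ 2 + η * (A / G)) * y ω ^ 2 := by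
    intro ω
    have h : 2 * (x ω * y ω) ≤ G / A * x ω ^ 2 + A / G * y ω ^ 2 := by
      have h1 : 0 ≤ (G * x ω - A * y ω) ^ 2 / (A * G) := by positivity
      have h2 : (G * x ω - A * y ω) ^ 2 / (A * G) =
          G / A * x ω ^ 2 + A / G * y ω ^ 2 - 2 * (x ω * y ω) := by
        field_simp; ring
      linarith
    nlinarith [mul_le_mul_of_nonneg_left h hη]
  refine ⟨((hx.const_mul _).add (hy.const_mul _)).mono' ((hxm.add (hym.const_mul η)).pow 2)
    (ae_of_all _ fun ω => (Real.norm_of_nonneg (sq_nonneg _)).le.trans (hpt ω)), ?_⟩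
  calc ∫ ω, (x ω + η * y ω) ^ 2 ∂P
      ≤ ∫ ω, ((1 + η * (G / A)) * x ω ^ 2 + (η ^ 2 + η * (A / G)) * y ω ^ 2) ∂P :=
        integral_mono_of_nonneg (ae_of_all _ fun ω => sq_nonneg _)
          ((hx.const_mul _).add (hy.const_mul _)) (ae_of_all _ hpt)
    _ = (1 + η * (G / A)) * ∫ ω, x ω ^ 2 ∂P + (η ^ 2 + η * (A / G)) * ∫ ω, y ω ^ 2 ∂P := by
        rw [integral_add (hx.const_mul _) (hy.const_mul _), integral_const_mul,
          integral_const_mul]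
    _ ≤ (1 + η * (G / A)) * A ^ 2 + (η ^ 2 + η * (A / G)) * G ^ 2 := by gcongr
    _ = (A + η * G) ^ 2 := by field_simp; ring

/-- Dropping the square root from the recursion, the `L²` norm of `δ t` grows at most
logarithmically: each step adds `t^(-2/3)` times an `L²` norm of order `t^(-1/3)`. -/
theorem sqrt_recursion_second_moment {a B D₀ : ℝ} (ha : 0 ≤ a) (hB : 0 < B) (hD₀ : 0 < D₀)
    {δ E : ℕ → Ω → ℝ} (hδ : ∀ t, 1 ≤ t → ∀ ω, 0 ≤ δ t ω)
    (hδm : ∀ t, 1 ≤ t → AEStronglyMeasurable (δ t) P)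
    (hEm : ∀ t, 1 ≤ t → AEStronglyMeasurable (E t) P)
    (hδi : ∀ t, 1 ≤ t → Integrable (fun ω => δ t ω ^ 2) P)
    (hEi : ∀ t, 1 ≤ t → Integrable (fun ω => E t ω ^ 2) P)
    (hEb : ∀ t : ℕ, 1 ≤ t → ∫ ω, E t ω ^ 2 ∂P ≤ B ^ 2 * (t : ℝ) ^ (-(2 / 3) : ℝ))
    (hstep : ∀ t : ℕ, 1 ≤ t → ∀ᵐ ω ∂P,
      δ (t + 1) ω ≤ δ t ω + (t : ℝ) ^ (-(2 / 3) : ℝ) * (E t ω - a * √(δ t ω)))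
    (h1 : ∫ ω, δ 1 ω ^ 2 ∂P ≤ D₀ ^ 2) (t : ℕ) (ht : 1 ≤ t) :
    ∫ ω, δ t ω ^ 2 ∂P ≤ (D₀ + B * ∑ s ∈ Finset.Ico 1 t, (1 : ℝ) / s) ^ 2 := by
  induction t, ht using Nat.le_induction with
  | base => simpa using h1
  | succ t ht ih =>
    have ht0 : (0 : ℝ) < t := by exact_mod_cast ht
    have hA : 0 < D₀ + B * ∑ s ∈ Finset.Ico 1 t, (1 : ℝ) / s := by
      have : 0 ≤ ∑ s ∈ Finset.Ico 1 t, (1 : ℝ) / s := Finset.sum_nonneg fun s _ => by positivity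
      positivity
    have hG : 0 < B * (t : ℝ) ^ (-(1 / 3) : ℝ) := by positivity
    have hη : 0 ≤ (t : ℝ) ^ (-(2 / 3) : ℝ) := by positivity
    have hG2 : ∫ ω, E t ω ^ 2 ∂P ≤ (B * (t : ℝ) ^ (-(1 / 3) : ℝ)) ^ 2 := by
      refine (hEb t ht).trans_eq ?_
      rw [mul_pow, ← Real.rpow_natCast ((t : ℝ) ^ (-(1 / 3) : ℝ)), ← Real.rpow_mul ht0.le]
      norm_num
    obtain ⟨hMi, hM⟩ := integral_add_mul_sq_le hη hA hG (hδm t ht) (hEm t ht) (hδi t ht) (hEi t ht) ih hG2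
    have hsum : D₀ + B * ∑ s ∈ Finset.Ico 1 t, (1 : ℝ) / s
        + (t : ℝ) ^ (-(2 / 3) : ℝ) * (B * (t : ℝ) ^ (-(1 / 3) : ℝ)) =
        D₀ + B * ∑ s ∈ Finset.Ico 1 (t + 1), (1 : ℝ) / s := by
      have : (t : ℝ) ^ (-(2 / 3) : ℝ) * (t : ℝ) ^ (-(1 / 3) : ℝ) = 1 / t := by
        rw [← Real.rpow_add ht0, one_div]; norm_num [Real.rpow_neg_one]
      rw [Finset.sum_Ico_succ_top ht, mul_add, ← this]; ring
    rw [hsum] at hM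
    refine le_trans (integral_mono_of_nonneg (ae_of_all _ fun ω => sq_nonneg _) hMi ?_) hM
    filter_upwards [hstep t ht] with ω hω
    refine pow_le_pow_left₀ (hδ (t + 1) (by omega) ω) (hω.trans ?_) 2
    have := mul_nonneg ha (Real.sqrt_nonneg (δ t ω))
    gcongr
    linarith

/-- The rate of a nonnegative process with `δ (t + 1) ≤ δ t + t^(-2/3) (E t - 4 k √(δ t))`, whose
perturbations satisfy `𝔼 (E t)² ≤ B² t^(-2/3)`. The constant depends on `k` and `B` only; the
initial value enters through the time from which the bound holds. -/
theorem sqrt_recursion_rate [IsProbabilityMeasure P] {k B D₀ : ℝ} (hk : 0 < k) (hB : 0 < B)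
    (hD₀ : 0 < D₀) {δ E : ℕ → Ω → ℝ} (hδ : ∀ t, 1 ≤ t → ∀ ω, 0 ≤ δ t ω)
    (hE : ∀ t, 1 ≤ t → ∀ ω, 0 ≤ E t ω) (hδm : ∀ t, 1 ≤ t → AEStronglyMeasurable (δ t) P)
    (hEm : ∀ t, 1 ≤ t → AEStronglyMeasurable (E t) P)
    (hδi : ∀ t, 1 ≤ t → Integrable (fun ω => δ t ω ^ 2) P)
    (hEi : ∀ t, 1 ≤ t → Integrable (fun ω => E t ω ^ 2) P)
    (hEb : ∀ t : ℕ, 1 ≤ t → ∫ ω, E t ω ^ 2 ∂P ≤ B ^ 2 * (t : ℝ) ^ (-(2 / 3) : ℝ))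
    (hstep : ∀ t : ℕ, 1 ≤ t → ∀ᵐ ω ∂P,
      δ (t + 1) ω ≤ δ t ω + (t : ℝ) ^ (-(2 / 3) : ℝ) * (E t ω - 4 * k * √(δ t ω)))
    (h1 : ∫ ω, δ 1 ω ^ 2 ∂P ≤ D₀ ^ 2) :
    ∃ T₀ : ℕ, ∀ T : ℕ, T₀ ≤ T → ∫ ω, δ (T + 1) ω ∂P ≤
      (2 + 8 / k ^ 2 * (1 + 2 * B) ^ 2 + 48 / (min k (1 / 4) * min 1 k) * B ^ 2) *
        ((Real.log T) ^ 2 / (T : ℝ) ^ (2 / 3 : ℝ)) := by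
  have hlarge : ∀ᶠ T : ℕ in Filter.atTop, max 1 D₀ ≤ Real.log T :=
    (Real.tendsto_log_atTop.comp tendsto_natCast_atTop_atTop).eventually_ge_atTop _
  obtain ⟨T₀, hT₀⟩ := Filter.eventually_atTop.1 (hlarge.and (Filter.eventually_ge_atTop 2))
  refine ⟨T₀, fun T hTT => ?_⟩
  obtain ⟨hlog, hT2⟩ := hT₀ T hTT
  have hl1 : 1 ≤ Real.log T := (le_max_left _ _).trans hlog
  have hlD : D₀ ≤ Real.log T := (le_max_right _ _).trans hlog
  have hT0 : (0 : ℝ) < T := by exact_mod_cast (by omega : 0 < T)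
  have hT2' : (2 : ℝ) ≤ T := by exact_mod_cast hT2
  obtain ⟨l, hl⟩ : ∃ l, l = Real.log T := ⟨_, rfl⟩
  obtain ⟨p, hp⟩ : ∃ p, p = (T : ℝ) ^ (-(2 / 3) : ℝ) := ⟨_, rfl⟩
  obtain ⟨c, hc⟩ : ∃ c, c = min k (1 / 4) := ⟨_, rfl⟩
  obtain ⟨c', hc'⟩ : ∃ c', c' = min 1 k := ⟨_, rfl⟩
  have hc0 : 0 < c := hc ▸ lt_min hk (by norm_num)
  have hc0' : 0 < c' := hc' ▸ lt_min one_pos hk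
  have hp0 : 0 < p := hp ▸ Real.rpow_pos_of_pos hT0 _
  have hp1 : p ≤ 1 := hp ▸ Real.rpow_le_one_of_one_le_of_nonpos (by linarith) (by norm_num)
  have hrate : (Real.log T) ^ 2 / (T : ℝ) ^ (2 / 3 : ℝ) = p * l ^ 2 := by
    rw [hp, hl, Real.rpow_neg hT0.le, div_eq_mul_inv, mul_comm]
  rw [hrate, ← hc, ← hc']
  rw [← hl] at hl1 hlD
  set S := Finset.Ico ((T + 1) / 2) (T + 1) with hS
  have hw : ∀ t ∈ S, 1 ≤ t ∧ 0 < 1 + k * ((T : ℝ) - t) ∧ (t : ℝ) ^ (-(2 / 3) : ℝ) ≤ 2 * p := by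
    intro t ht
    rw [hS, Finset.mem_Ico] at ht
    have htT : (t : ℝ) ≤ T := by exact_mod_cast (by omega : t ≤ T)
    refine ⟨by omega, ?_, ?_⟩
    · have := mul_nonneg hk.le (sub_nonneg.2 htT)
      linarith
    · rw [hp]
      exact rpow_neg_two_thirds_le hT0 (by exact_mod_cast (by omega : T ≤ 2 * t))
  have hint : Integrable (fun ω => ∑ t ∈ S, E t ω ^ 2 / (1 + k * ((T : ℝ) - t))) P :=
    integrable_finsetSum _ fun t ht => (hEi t (hw t ht).1).div_const _
  have hpath : ∀ᵐ ω ∂P, δ (T + 1) ω ≤ 2 * p ^ 2 + 8 / k ^ 2 * p * δ ((T + 1) / 2) ω ^ 2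
      + 8 / c * ∑ t ∈ S, E t ω ^ 2 / (1 + k * ((T : ℝ) - t)) := by
    have hall : ∀ᵐ ω ∂P, ∀ t : ℕ, 1 ≤ t → δ (t + 1) ω ≤
        δ t ω + (t : ℝ) ^ (-(2 / 3) : ℝ) * (E t ω - 4 * k * √(δ t ω)) :=
      ae_all_iff.2 fun t => by
        by_cases ht : 1 ≤ t
        · filter_upwards [hstep t ht] with ω h _ using h
        · exact ae_of_all _ fun ω h => absurd h ht
    filter_upwards [hall] with ω hω
    rw [hp, hc]
    exact sqrt_recursion_half_run hk (δ := fun t => δ t ω) (E := fun t => E t ω)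
      (fun t ht => hδ t ht ω) (fun t ht => hE t ht ω) hω (by omega)
  have hsecond : ∫ ω, δ ((T + 1) / 2) ω ^ 2 ∂P ≤ ((1 + 2 * B) * l) ^ 2 := by
    refine (sqrt_recursion_second_moment (by positivity) hB hD₀ hδ hδm hEm hδi hEi hEb hstep h1
      ((T + 1) / 2) (by omega)).trans ?_
    have hs : ∑ s ∈ Finset.Ico 1 ((T + 1) / 2), (1 : ℝ) / s ≤ 1 + l := by
      rw [hl]
      refine le_trans (Finset.sum_le_sum_of_subset_of_nonneg
        (Finset.Ico_subset_Ico_right (by omega)) fun _ _ _ => by positivity) (sum_Ico_one_div_le T)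
    have hs0 : 0 ≤ ∑ s ∈ Finset.Ico 1 ((T + 1) / 2), (1 : ℝ) / s :=
      Finset.sum_nonneg fun s _ => by positivity
    refine pow_le_pow_left₀ (by positivity) ?_ 2
    nlinarith
  have hcost : ∫ ω, ∑ t ∈ S, E t ω ^ 2 / (1 + k * ((T : ℝ) - t)) ∂P ≤
      B ^ 2 * (2 * p) * (3 * l / c') := by
    have hlogT : 1 + Real.log (T + 1) ≤ 3 * l := by
      have : Real.log (T + 1) ≤ 2 * l := by
        rw [hl, ← Nat.cast_ofNat, ← Real.log_pow]
        refine Real.log_le_log (by linarith) ?_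
        nlinarith
      linarith
    rw [integral_finsetSum _ fun t ht => (hEi t (hw t ht).1).div_const _]
    calc ∑ t ∈ S, ∫ ω, E t ω ^ 2 / (1 + k * ((T : ℝ) - t)) ∂P
        ≤ ∑ t ∈ S, B ^ 2 * (2 * p) * (1 / (1 + k * ((T : ℝ) - t))) := by
          refine Finset.sum_le_sum fun t ht => ?_
          obtain ⟨ht1, hpos, htp⟩ := hw t ht
          rw [integral_div, mul_one_div]
          have := hEb t ht1
          gcongr
          exact this.trans (by gcongr)
      _ = B ^ 2 * (2 * p) * ∑ t ∈ S, 1 / (1 + k * ((T : ℝ) - t)) := by rw [Finset.mul_sum]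
      _ ≤ B ^ 2 * (2 * p) * (3 * l / c') := by
          have h := sum_Ico_weights_le hk ((T + 1) / 2) T
          rw [← hc'] at h
          have h2 : (1 + Real.log (T + 1)) / c' ≤ 3 * l / c' := by gcongr
          have h3 := h.trans h2
          gcongr
  have hi1 := (hδi ((T + 1) / 2) (by omega)).const_mul (8 / k ^ 2 * p)
  have hi2 := hint.const_mul (8 / c)
  have hi3 : Integrable (fun ω => 2 * p ^ 2 + 8 / k ^ 2 * p * δ ((T + 1) / 2) ω ^ 2) P :=
    (integrable_const _).add hi1
  calc ∫ ω, δ (T + 1) ω ∂P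
      ≤ ∫ ω, (2 * p ^ 2 + 8 / k ^ 2 * p * δ ((T + 1) / 2) ω ^ 2
          + 8 / c * ∑ t ∈ S, E t ω ^ 2 / (1 + k * ((T : ℝ) - t))) ∂P :=
        integral_mono_of_nonneg (ae_of_all _ fun ω => hδ (T + 1) (by omega) ω)
          (hi3.add hi2) hpath
    _ = 2 * p ^ 2 + 8 / k ^ 2 * p * ∫ ω, δ ((T + 1) / 2) ω ^ 2 ∂P
          + 8 / c * ∫ ω, ∑ t ∈ S, E t ω ^ 2 / (1 + k * ((T : ℝ) - t)) ∂P := by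
        rw [integral_add hi3 hi2, integral_add (integrable_const _) hi1]
        simp only [integral_const_mul, integral_const, probReal_univ, one_smul]
    _ ≤ 2 * p ^ 2 + 8 / k ^ 2 * p * ((1 + 2 * B) * l) ^ 2
          + 8 / c * (B ^ 2 * (2 * p) * (3 * l / c')) := by gcongr
    _ ≤ 2 * (p * l ^ 2) + 8 / k ^ 2 * p * ((1 + 2 * B) * l) ^ 2
          + 8 / c * (B ^ 2 * (2 * p) * (3 * l ^ 2 / c')) := by
        have h2 : l ≤ l ^ 2 := by nlinarith
        have h3 : p ^ 2 ≤ p * l ^ 2 := by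
          have : p ≤ l ^ 2 := by linarith
          rw [sq]; gcongr
        gcongr
    _ = (2 + 8 / k ^ 2 * (1 + 2 * B) ^ 2 + 48 / (c * c') * B ^ 2) * (p * l ^ 2) := by
        field_simp; ring

end SquareRootProcess

/-! ### The momentum error -/

section Momentum

variable {m n : ℕ} {Z : Type*} [MeasurableSpace Z] {D : Measure Z} {F : Z → FrobSpace m n → ℝ}
  {L σ : ℝ}

theorem norm_add_sq_le_two {E : Type*} [NormedAddCommGroup E] (a b : E) :
    ‖a + b‖ ^ 2 ≤ 2 * ‖a‖ ^ 2 + 2 * ‖b‖ ^ 2 := by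
  have h : ‖a + b‖ ^ 2 ≤ (‖a‖ + ‖b‖) ^ 2 := by gcongr; exact norm_add_le a b
  nlinarith [sq_nonneg (‖a‖ - ‖b‖)]

/-- The conditional second moment of the momentum error after one step, given the momentum `M` and
the iterates `X`, `Y`: only the fresh sample `z` is random. The new error is the old one, damped by
`β`, plus a centred term whose second moment is controlled by the variance and by smoothness. -/
theorem momentum_error_sample_step [IsProbabilityMeasure D]
    (hσ : HasUnbiasedBoundedVariance D F σ) (hL : IsSampleSmooth F L) {β : ℝ} (hβ0 : 0 ≤ β)
    (hβ1 : β ≤ 1) (M X Y : FrobSpace m n) :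
    Integrable (fun z => ‖β • M + (1 - β) • gradient (F z) Y
      + β • (gradient (F z) Y - gradient (F z) X) - gradient (objective D F) Y‖ ^ 2) D ∧
    ∫ z, ‖β • M + (1 - β) • gradient (F z) Y
      + β • (gradient (F z) Y - gradient (F z) X) - gradient (objective D F) Y‖ ^ 2 ∂D ≤
      β * ‖M - gradient (objective D F) X‖ ^ 2
        + (2 * (1 - β) ^ 2 * σ ^ 2 + 8 * L ^ 2 * ‖Y - X‖ ^ 2) := by
  set g := gradient (objective D F) with hg
  set e := M - g X with he
  set N : Z → FrobSpace m n := fun z => (1 - β) • (gradient (F z) Y - g Y)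
    + β • ((gradient (F z) Y - gradient (F z) X) - (g Y - g X)) with hN
  have hd0 : Integrable (fun z => gradient (F z) Y - gradient (F z) X) D :=
    (hσ.grad_integrable Y).sub (hσ.grad_integrable X)
  have hd1 : Integrable (fun z => (1 - β) • (gradient (F z) Y - g Y)) D :=
    ((hσ.grad_integrable Y).sub (integrable_const _)).smul (1 - β)
  have hd2 : Integrable
      (fun z => β • ((gradient (F z) Y - gradient (F z) X) - (g Y - g X))) D :=
    (hd0.sub (integrable_const _)).smul β
  have hN1 : Integrable N D := hd1.add hd2
  have hN0 : ∫ z, N z ∂D = 0 := by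
    simp only [hN]
    rw [integral_add hd1 hd2, integral_smul, integral_smul,
      integral_sub (hσ.grad_integrable Y) (integrable_const _),
      integral_sub hd0 (integrable_const _),
      integral_sub (hσ.grad_integrable Y) (hσ.grad_integrable X), hσ.unbiased, hσ.unbiased]
    simp [hg]
  have hNb : ∀ z, ‖N z‖ ^ 2 ≤
      2 * (1 - β) ^ 2 * ‖gradient (F z) Y - g Y‖ ^ 2 + 8 * L ^ 2 * ‖Y - X‖ ^ 2 := by
    intro z
    have h1 : ‖(gradient (F z) Y - gradient (F z) X) - (g Y - g X)‖ ≤ 2 * L * ‖Y - X‖ := by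
      have := norm_sub_le (gradient (F z) Y - gradient (F z) X) (g Y - g X)
      have := hL z X Y
      have := hσ.norm_gradient_sub_le hL X Y
      linarith
    have h2 : ‖β • ((gradient (F z) Y - gradient (F z) X) - (g Y - g X))‖ ≤
        2 * L * ‖Y - X‖ := by
      rw [norm_smul, Real.norm_of_nonneg hβ0]
      exact (mul_le_of_le_one_left (norm_nonneg _) hβ1).trans h1
    have h3 : ‖β • ((gradient (F z) Y - gradient (F z) X) - (g Y - g X))‖ ^ 2 ≤
        (2 * L * ‖Y - X‖) ^ 2 := by gcongr
    have h4 := norm_add_sq_le_two ((1 - β) • (gradient (F z) Y - g Y))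
      (β • ((gradient (F z) Y - gradient (F z) X) - (g Y - g X)))
    rw [norm_smul, mul_pow, Real.norm_eq_abs, sq_abs] at h4
    refine h4.trans ?_
    linarith
  have hdom : Integrable (fun z =>
      2 * (1 - β) ^ 2 * ‖gradient (F z) Y - g Y‖ ^ 2 + 8 * L ^ 2 * ‖Y - X‖ ^ 2) D :=
    ((hσ.sq_integrable Y).const_mul _).add (integrable_const _)
  have hN2 : Integrable (fun z => ‖N z‖ ^ 2) D :=
    hdom.mono' (hN1.1.norm.pow 2) (ae_of_all _ fun z => by
      rw [Real.norm_of_nonneg (sq_nonneg _)]; exact hNb z)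
  have hN2b : ∫ z, ‖N z‖ ^ 2 ∂D ≤ 2 * (1 - β) ^ 2 * σ ^ 2 + 8 * L ^ 2 * ‖Y - X‖ ^ 2 := by
    refine (integral_mono hN2 hdom hNb).trans ?_
    rw [integral_add ((hσ.sq_integrable Y).const_mul _) (integrable_const _), integral_const_mul]
    simp only [integral_const, probReal_univ, one_smul]
    gcongr
    exact hσ.variance_le Y
  have heq : (fun z => ‖β • M + (1 - β) • gradient (F z) Y
      + β • (gradient (F z) Y - gradient (F z) X) - g Y‖ ^ 2) =
      fun z => β ^ 2 * ‖e‖ ^ 2 + 2 * β * inner ℝ e (N z) + ‖N z‖ ^ 2 := by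
    funext z
    have : β • M + (1 - β) • gradient (F z) Y
        + β • (gradient (F z) Y - gradient (F z) X) - g Y = β • e + N z := by
      simp only [he, hN]; module
    rw [this, norm_add_sq_real, norm_smul, mul_pow, Real.norm_eq_abs, sq_abs, real_inner_smul_left]
    ring
  have hi : Integrable (fun z => β ^ 2 * ‖e‖ ^ 2 + 2 * β * inner ℝ e (N z)) D :=
    (integrable_const _).add ((hN1.const_inner e).const_mul _)
  rw [heq]
  refine ⟨hi.add hN2, ?_⟩
  rw [integral_add hi hN2, integral_add (integrable_const _) ((hN1.const_inner e).const_mul _),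
    integral_const_mul (2 * β), integral_inner hN1 e, hN0]
  simp only [integral_const, probReal_univ, one_smul, inner_zero_right, mul_zero, add_zero]
  have : β ^ 2 * ‖e‖ ^ 2 ≤ β * ‖e‖ ^ 2 := by
    gcongr
    nlinarith
  linarith

end Momentum

section Run

variable {m n : ℕ} {Z Ω : Type*} [MeasurableSpace Z] [mΩ : MeasurableSpace Ω] {D : Measure Z}
  {F : Z → FrobSpace m n → ℝ} {L σ : ℝ} {P : Measure Ω} {𝓕 : Filtration ℕ mΩ} {ξ : ℕ → Ω → Z}
  {η β : ℕ → ℝ} {γ : ℝ} {x₁ : FrobSpace m n} {X M O : ℕ → Ω → FrobSpace m n}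

/-- Expectation of a nonnegative function of an `𝓕 t`-measurable variable and of the next sample:
the sample may be integrated out first. -/
theorem IsFreshSampling.lintegral_eq [IsProbabilityMeasure P] [IsProbabilityMeasure D]
    (hξ : IsFreshSampling P D 𝓕 ξ) {S : Type*} [MeasurableSpace S] {Y : Ω → S} {t : ℕ}
    (hY : Measurable[𝓕 t] Y) {G : S × Z → ENNReal} (hG : Measurable G) :
    ∫⁻ ω, G (Y ω, ξ (t + 1) ω) ∂P = ∫⁻ ω, ∫⁻ z, G (Y ω, z) ∂D ∂P := by
  have hYm : Measurable Y := hY.mono (𝓕.le t) le_rfl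
  have hξm : Measurable (ξ (t + 1)) := (hξ.adapted (t + 1) (by omega)).mono (𝓕.le _) le_rfl
  have hind : IndepFun Y (ξ (t + 1)) P := by
    rw [IndepFun_iff_Indep]
    exact indep_of_indep_of_le_left (hξ.indep t) hY.comap_le
  have hprod := (indepFun_iff_map_prod_eq_prod_map_map hYm.aemeasurable hξm.aemeasurable).1 hind
  rw [hξ.law (t + 1) (by omega)] at hprod
  rw [← lintegral_map (f := G) hG (hYm.prodMk hξm), hprod, lintegral_prod _ hG.aemeasurable,
    lintegral_map hG.lintegral_prod_right' hYm]

theorem IsMuonMVR2Run.measurable_iterate {Z : Type*} {F : Z → FrobSpace m n → ℝ} {ξ : ℕ → Ω → Z}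
    (hrun : IsMuonMVR2Run F 𝓕 ξ η β γ x₁ X M O) (t : ℕ)
    (ht : 1 ≤ t) : Measurable[𝓕 t] (X t) ∧ Measurable[𝓕 t] (X (t + 1)) := by
  have hsucc : ∀ t, 1 ≤ t → Measurable[𝓕 t] (X t) → Measurable[𝓕 t] (X (t + 1)) := by
    intro t ht h
    rw [show X (t + 1) = fun ω => X t ω - η t • O t ω from funext (hrun.iterate_succ t ht)]
    exact h.sub ((hrun.direction_adapted t ht).const_smul (η t))
  have h0 : Measurable[𝓕 t] (X t) := by
    induction t, ht using Nat.le_induction with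
    | base =>
      rw [show X 1 = fun _ => x₁ from funext hrun.iterate_one]
      exact measurable_const
    | succ t ht ih => exact (hsucc t ht ih).mono (𝓕.mono (Nat.le_succ t)) le_rfl
  exact ⟨h0, hsucc t ht h0⟩

theorem IsMuonMVR2Run.measurable_momentum (hrun : IsMuonMVR2Run F 𝓕 ξ η β γ x₁ X M O)
    (hF : IsStochasticProblem D F) (hL : IsSampleSmooth F L) (hξ : IsFreshSampling P D 𝓕 ξ)
    (t : ℕ) (ht : 1 ≤ t) : Measurable[𝓕 t] (M t) := by
  have hgrad : ∀ t, 1 ≤ t → ∀ Y : Ω → FrobSpace m n, Measurable[𝓕 t] Y →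
      Measurable[𝓕 t] fun ω => gradient (F (ξ t ω)) (Y ω) := fun t ht Y hY =>
    (hF.measurable_gradient_uncurry hL).comp (hY.prodMk (hξ.adapted t ht))
  induction t, ht using Nat.le_induction with
  | base =>
    rw [show M 1 = _ from funext hrun.momentum_one]
    have h1 := hgrad 1 le_rfl _ (hrun.measurable_iterate 1 le_rfl).1
    simp only [hrun.momentum_zero]
    exact ((measurable_const).add (h1.const_smul (1 - β 1))).add
      ((h1.sub measurable_const).const_smul (γ * β 1))
  | succ t ht ih =>
    rw [show M (t + 1) = _ from funext (hrun.momentum_succ t ht)]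
    have hm : 𝓕 t ≤ 𝓕 (t + 1) := 𝓕.mono (Nat.le_succ t)
    have h1 := hgrad (t + 1) (by omega) _ (hrun.measurable_iterate (t + 1) (by omega)).1
    have h2 := hgrad (t + 1) (by omega) _ ((hrun.measurable_iterate t ht).1.mono hm le_rfl)
    exact (((ih.mono hm le_rfl).const_smul (β (t + 1))).add
      (h1.const_smul (1 - β (t + 1)))).add ((h1.sub h2).const_smul (γ * β (t + 1)))

end Run

/-- The induction step for a recursion `v (t + 1) ≤ (1 - α) v t + Q α²` with `α = (t + 1)^(-2/3)`:
it preserves `v t ≤ G t^(-2/3)`, since `t^(-2/3)` decreases by less than a damping factor. -/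
theorem rpow_neg_two_thirds_succ {t : ℝ} (ht : 1 ≤ t) {G Q : ℝ} (hG : 0 ≤ G) (hQ : 3 * Q ≤ G) :
    (1 - (t + 1) ^ (-(2 / 3) : ℝ)) * (G * t ^ (-(2 / 3) : ℝ))
      + Q * ((t + 1) ^ (-(2 / 3) : ℝ)) ^ 2 ≤ G * (t + 1) ^ (-(2 / 3) : ℝ) := by
  have ht0 : 0 < t := by linarith
  obtain ⟨p, hp⟩ : ∃ p, p = t ^ (-(2 / 3) : ℝ) := ⟨_, rfl⟩
  obtain ⟨q, hq⟩ : ∃ q, q = (t + 1) ^ (-(2 / 3) : ℝ) := ⟨_, rfl⟩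
  have hp0 : 0 < p := hp ▸ Real.rpow_pos_of_pos ht0 _
  have hq0 : 0 < q := hq ▸ Real.rpow_pos_of_pos (by linarith) _
  have hqp : q ≤ p := by
    rw [hp, hq]
    exact Real.rpow_le_rpow_of_nonpos ht0 (by linarith) (by norm_num)
  -- Bernoulli's inequality: `(t + 1)^(2/3) ≤ t^(2/3) + 2/3`.
  have hpq : p ≤ q + 2 / 3 * (p * q) := by
    have h1 : (t + 1) ^ (2 / 3 : ℝ) ≤ t ^ (2 / 3 : ℝ) + 2 / 3 := by
      have h2 : (t + 1) = t * (1 + 1 / t) := by field_simp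
      rw [h2, Real.mul_rpow ht0.le (by positivity)]
      have h3 : (1 + 1 / t) ^ (2 / 3 : ℝ) ≤ 1 + 2 / 3 * (1 / t) :=
        rpow_one_add_le_one_add_mul_self (by have : 0 ≤ 1 / t := by positivity
                                             linarith) (by norm_num) (by norm_num)
      have h4 : t ^ (2 / 3 : ℝ) ≤ t := by
        calc t ^ (2 / 3 : ℝ) ≤ t ^ (1 : ℝ) :=
              Real.rpow_le_rpow_of_exponent_le ht (by norm_num)
          _ = t := Real.rpow_one t
      calc t ^ (2 / 3 : ℝ) * (1 + 1 / t) ^ (2 / 3 : ℝ)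
          ≤ t ^ (2 / 3 : ℝ) * (1 + 2 / 3 * (1 / t)) := by gcongr
        _ = t ^ (2 / 3 : ℝ) + 2 / 3 * (t ^ (2 / 3 : ℝ) / t) := by ring
        _ ≤ t ^ (2 / 3 : ℝ) + 2 / 3 * 1 := by
            gcongr
            exact (div_le_one ht0).2 h4
        _ = t ^ (2 / 3 : ℝ) + 2 / 3 := by ring
    have hpi : p⁻¹ = t ^ (2 / 3 : ℝ) := by rw [hp, ← Real.rpow_neg ht0.le, neg_neg]
    have hqi : q⁻¹ = (t + 1) ^ (2 / 3 : ℝ) := by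
      rw [hq, ← Real.rpow_neg (by linarith), neg_neg]
    rw [← hpi, ← hqi] at h1
    have h2 := mul_le_mul_of_nonneg_left h1 (mul_pos hp0 hq0).le
    have e1 : p * q * q⁻¹ = p := by field_simp
    have e2 : p * q * (p⁻¹ + 2 / 3) = q + 2 / 3 * (p * q) := by field_simp
    rwa [e1, e2] at h2
  rw [← hp, ← hq]
  have h1 : Q * q ^ 2 ≤ G / 3 * q ^ 2 := by
    gcongr
    linarith
  have h2 : G * p ≤ G * (q + 2 / 3 * (p * q)) := by gcongr
  have h3 : G * q * q ≤ G * q * p := by gcongr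
  linarith

/-! ### Convergence rate -/

section Rate

variable {m n : ℕ} {Z Ω : Type*} [MeasurableSpace Z] [mΩ : MeasurableSpace Ω] {D : Measure Z}
  {F : Z → FrobSpace m n → ℝ} {L σ : ℝ} {P : Measure Ω} {𝓕 : Filtration ℕ mΩ} {ξ : ℕ → Ω → Z}
  {x₁ : FrobSpace m n} {X M O : ℕ → Ω → FrobSpace m n}

/-- The second moment of the momentum error decays like `t^(-2/3)`: it is damped by `1 - t^(-2/3)`
and receives a contribution of order `t^(-4/3)` in each step. -/
theorem IsMuonMVR2Run.lintegral_momentum_error_le [IsProbabilityMeasure P] [IsProbabilityMeasure D]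
    (hmn : n ≤ m) (hF : IsStochasticProblem D F) (hL : IsSampleSmooth F L)
    (hσ : HasUnbiasedBoundedVariance D F σ) (hξ : IsFreshSampling P D 𝓕 ξ)
    (hrun : IsMuonMVR2Run F 𝓕 ξ (fun t => (t : ℝ) ^ (-(2 / 3) : ℝ))
      (fun t => 1 - (t : ℝ) ^ (-(2 / 3) : ℝ)) 1 x₁ X M O) (t : ℕ) (ht : 1 ≤ t) :
    ∫⁻ ω, ENNReal.ofReal (‖M t ω - gradient (objective D F) (X t ω)‖ ^ 2) ∂P ≤
      ENNReal.ofReal ((6 * σ ^ 2 + 96 * L ^ 2 * n) * (t : ℝ) ^ (-(2 / 3) : ℝ)) := by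
  have hg : Measurable (gradient (objective D F)) :=
    (continuous_gradient_objective hσ hL).measurable
  have hGF := hF.measurable_gradient_uncurry hL
  induction t, ht using Nat.le_induction with
  | base =>
    have hM1 : ∀ ω, M 1 ω = gradient (F (ξ 1 ω)) x₁ := fun ω => by
      rw [hrun.momentum_one, hrun.momentum_zero, hrun.iterate_one]; simp
    simp only [hM1, hrun.iterate_one]
    have h := hξ.lintegral_eq (t := 0) (Y := fun _ => x₁) measurable_const
      (G := fun p => ENNReal.ofReal
        (‖gradient (F p.2) p.1 - gradient (objective D F) p.1‖ ^ 2))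
      ((hGF.sub (hg.comp measurable_fst)).norm.pow_const 2).ennreal_ofReal
    simp only [zero_add] at h
    rw [h, lintegral_const, measure_univ, mul_one, ← ofReal_integral_eq_lintegral_ofReal
      (hσ.sq_integrable x₁) (ae_of_all _ fun z => sq_nonneg _)]
    refine ENNReal.ofReal_le_ofReal ((hσ.variance_le x₁).trans ?_)
    have : 0 ≤ 96 * L ^ 2 * n := by positivity
    simp only [Nat.cast_one, Real.one_rpow, mul_one]
    nlinarith [sq_nonneg σ]
  | succ t ht ih =>
    have ht1 : (1 : ℝ) ≤ t := by exact_mod_cast ht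
    have ht0 : (0 : ℝ) < t := by linarith
    set q : ℝ := ((t : ℝ) + 1) ^ (-(2 / 3) : ℝ) with hq
    set p : ℝ := (t : ℝ) ^ (-(2 / 3) : ℝ) with hp
    have hq0 : 0 < q := Real.rpow_pos_of_pos (by linarith) _
    have hp0 : 0 < p := Real.rpow_pos_of_pos ht0 _
    have hq1 : q ≤ 1 := Real.rpow_le_one_of_one_le_of_nonpos (by linarith) (by norm_num)
    have hp2q : p ≤ 2 * q := rpow_neg_two_thirds_le (by linarith) (by linarith)
    have hY : Measurable[𝓕 t] fun ω => (M t ω, X t ω, X (t + 1) ω) :=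
      (hrun.measurable_momentum hF hL hξ t ht).prodMk
        ((hrun.measurable_iterate t ht).1.prodMk (hrun.measurable_iterate t ht).2)
    -- The squared error after the step, as a function of the past `(M, X, Y)` and the fresh sample.
    set H : (FrobSpace m n × FrobSpace m n × FrobSpace m n) × Z → ENNReal := fun p =>
      ENNReal.ofReal (‖(1 - q) • p.1.1 + (1 - (1 - q)) • gradient (F p.2) p.1.2.2
        + (1 - q) • (gradient (F p.2) p.1.2.2 - gradient (F p.2) p.1.2.1)
        - gradient (objective D F) p.1.2.2‖ ^ 2) with hH
    have hHm : Measurable H := by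
      have hY' : Measurable fun p : (FrobSpace m n × FrobSpace m n × FrobSpace m n) × Z =>
          p.1.2.2 := measurable_snd.comp (measurable_snd.comp measurable_fst)
      have hX' : Measurable fun p : (FrobSpace m n × FrobSpace m n × FrobSpace m n) × Z =>
          p.1.2.1 := measurable_fst.comp (measurable_snd.comp measurable_fst)
      have hM' : Measurable fun p : (FrobSpace m n × FrobSpace m n × FrobSpace m n) × Z =>
          p.1.1 := measurable_fst.comp measurable_fst
      have h1 := hGF.comp (hY'.prodMk measurable_snd)
      have h2 := hGF.comp (hX'.prodMk measurable_snd)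
      exact (((((hM'.const_smul (1 - q)).add (h1.const_smul (1 - (1 - q)))).add
        ((h1.sub h2).const_smul (1 - q))).sub (hg.comp hY')).norm.pow_const 2).ennreal_ofReal
    have hlaw : ∫⁻ ω, ENNReal.ofReal
        (‖M (t + 1) ω - gradient (objective D F) (X (t + 1) ω)‖ ^ 2) ∂P =
        ∫⁻ ω, ∫⁻ z, H ((M t ω, X t ω, X (t + 1) ω), z) ∂D ∂P := by
      rw [← hξ.lintegral_eq hY hHm]
      refine lintegral_congr fun ω => ?_
      rw [hrun.momentum_succ t ht]
      simp only [hH, one_mul, Nat.cast_add, Nat.cast_one]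
      rfl
    have hinner : ∀ ω, ∫⁻ z, H ((M t ω, X t ω, X (t + 1) ω), z) ∂D ≤
        ENNReal.ofReal (1 - q)
          * ENNReal.ofReal (‖M t ω - gradient (objective D F) (X t ω)‖ ^ 2)
          + ENNReal.ofReal ((2 * σ ^ 2 + 32 * L ^ 2 * n) * q ^ 2) := by
      intro ω
      obtain ⟨hi, hb⟩ := momentum_error_sample_step hσ hL (β := 1 - q) (by linarith)
        (by linarith) (M t ω) (X t ω) (X (t + 1) ω)
      simp only [hH]
      rw [← ofReal_integral_eq_lintegral_ofReal hi (ae_of_all _ fun z => sq_nonneg _),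
        ← ENNReal.ofReal_mul (by linarith), ← ENNReal.ofReal_add
          (mul_nonneg (by linarith) (sq_nonneg _)) (by positivity)]
      refine ENNReal.ofReal_le_ofReal (hb.trans ?_)
      have hO := ((hrun.direction t ht ω).norm_bounds hmn).1
      have hd : ‖X (t + 1) ω - X t ω‖ ^ 2 ≤ (2 * q) ^ 2 * n := by
        rw [hrun.iterate_succ t ht, sub_sub_cancel_left, norm_neg, norm_smul, mul_pow,
          Real.norm_of_nonneg hp0.le]
        gcongr
      have h2 : 8 * L ^ 2 * ‖X (t + 1) ω - X t ω‖ ^ 2 ≤ 8 * L ^ 2 * ((2 * q) ^ 2 * n) := by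
        gcongr
      rw [sub_sub_cancel]
      linarith
    rw [hlaw]
    calc ∫⁻ ω, ∫⁻ z, H ((M t ω, X t ω, X (t + 1) ω), z) ∂D ∂P
        ≤ ∫⁻ ω, (ENNReal.ofReal (1 - q)
          * ENNReal.ofReal (‖M t ω - gradient (objective D F) (X t ω)‖ ^ 2)
          + ENNReal.ofReal ((2 * σ ^ 2 + 32 * L ^ 2 * n) * q ^ 2)) ∂P := lintegral_mono hinner
      _ = ENNReal.ofReal (1 - q) * ∫⁻ ω, ENNReal.ofReal
            (‖M t ω - gradient (objective D F) (X t ω)‖ ^ 2) ∂P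
          + ENNReal.ofReal ((2 * σ ^ 2 + 32 * L ^ 2 * n) * q ^ 2) := by
          rw [lintegral_add_right _ measurable_const, lintegral_const_mul' _ _ ENNReal.ofReal_ne_top,
            lintegral_const, measure_univ, mul_one]
      _ ≤ ENNReal.ofReal (1 - q) * ENNReal.ofReal ((6 * σ ^ 2 + 96 * L ^ 2 * n) * p)
          + ENNReal.ofReal ((2 * σ ^ 2 + 32 * L ^ 2 * n) * q ^ 2) := by gcongr
      _ = ENNReal.ofReal ((1 - q) * ((6 * σ ^ 2 + 96 * L ^ 2 * n) * p)
          + (2 * σ ^ 2 + 32 * L ^ 2 * n) * q ^ 2) := by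
          rw [← ENNReal.ofReal_mul (by linarith), ← ENNReal.ofReal_add
            (mul_nonneg (by linarith) (by positivity)) (by positivity)]
      _ ≤ _ := by
          refine ENNReal.ofReal_le_ofReal ?_
          push_cast
          exact rpow_neg_two_thirds_succ ht1 (by positivity) (by linarith)

theorem IsMuonMVR2Run.momentum_error_le [IsProbabilityMeasure P] [IsProbabilityMeasure D]
    (hmn : n ≤ m) (hF : IsStochasticProblem D F) (hL : IsSampleSmooth F L)
    (hσ : HasUnbiasedBoundedVariance D F σ) (hξ : IsFreshSampling P D 𝓕 ξ)
    (hrun : IsMuonMVR2Run F 𝓕 ξ (fun t => (t : ℝ) ^ (-(2 / 3) : ℝ))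
      (fun t => 1 - (t : ℝ) ^ (-(2 / 3) : ℝ)) 1 x₁ X M O) (t : ℕ) (ht : 1 ≤ t) :
    Measurable (fun ω => ‖M t ω - gradient (objective D F) (X t ω)‖) ∧
    Integrable (fun ω => ‖M t ω - gradient (objective D F) (X t ω)‖ ^ 2) P ∧
    ∫ ω, ‖M t ω - gradient (objective D F) (X t ω)‖ ^ 2 ∂P ≤
      (6 * σ ^ 2 + 96 * L ^ 2 * n) * (t : ℝ) ^ (-(2 / 3) : ℝ) := by
  have hm : Measurable (fun ω => ‖M t ω - gradient (objective D F) (X t ω)‖) :=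
    (((hrun.measurable_momentum hF hL hξ t ht).mono (𝓕.le t) le_rfl).sub
      ((continuous_gradient_objective hσ hL).measurable.comp
        ((hrun.measurable_iterate t ht).1.mono (𝓕.le t) le_rfl))).norm
  have h := hrun.lintegral_momentum_error_le hmn hF hL hσ hξ t ht
  have hm2 : AEStronglyMeasurable
      (fun ω => ‖M t ω - gradient (objective D F) (X t ω)‖ ^ 2) P :=
    (hm.pow_const 2).aestronglyMeasurable
  refine ⟨hm, ⟨hm2, ?_⟩, ?_⟩
  · rw [hasFiniteIntegral_iff_ofReal (ae_of_all _ fun ω => sq_nonneg _)]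
    exact h.trans_lt ENNReal.ofReal_lt_top
  · rw [integral_eq_lintegral_of_nonneg_ae (ae_of_all _ fun ω => sq_nonneg _) hm2]
    exact ENNReal.toReal_le_of_le_ofReal (by positivity) h

/-- The iterates stay in a deterministic ball at each time, since all directions are bounded. -/
theorem IsMuonMVR2Run.exists_norm_le {Z : Type*} {F : Z → FrobSpace m n → ℝ} {ξ : ℕ → Ω → Z}
    {η β : ℕ → ℝ} {γ : ℝ} (hmn : n ≤ m)
    (hrun : IsMuonMVR2Run F 𝓕 ξ η β γ x₁ X M O) (t : ℕ) (ht : 1 ≤ t) :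
    ∃ R : ℝ, ∀ ω, ‖X t ω‖ ≤ R := by
  induction t, ht using Nat.le_induction with
  | base => exact ⟨‖x₁‖, fun ω => by rw [hrun.iterate_one]⟩
  | succ t ht ih =>
    obtain ⟨R, hR⟩ := ih
    refine ⟨R + |η t| * (n + 1), fun ω => ?_⟩
    rw [hrun.iterate_succ t ht]
    have hO := ((hrun.direction t ht ω).norm_bounds hmn).1
    have hO' : ‖O t ω‖ ≤ n + 1 := by nlinarith [norm_nonneg (O t ω), n.cast_nonneg (α := ℝ)]
    refine (norm_sub_le _ _).trans (add_le_add (hR ω) ?_)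
    rw [norm_smul, Real.norm_eq_abs]
    gcongr

/-- One step of the method lowers the objective by `η ‖∇f‖ / (n + 1)`, up to the momentum error and
a quadratic term. -/
theorem objective_muon_step_le [IsProbabilityMeasure D] (hmn : n ≤ m) (hL0 : 0 ≤ L)
    (hF : IsStochasticProblem D F) (hL : IsSampleSmooth F L)
    (hσ : HasUnbiasedBoundedVariance D F σ) {η : ℝ} (hη : 0 ≤ η) {x M O : FrobSpace m n}
    (h : IsMuonDirection M O) :
    objective D F (x - η • O) ≤ objective D F x
      + η * ((n + 2) * ‖M - gradient (objective D F) x‖ + L * n * η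
        - ‖gradient (objective D F) x‖ / (n + 1)) := by
  obtain ⟨hO, hM⟩ := h.norm_bounds hmn
  set g := gradient (objective D F) x
  have hn0 : (0 : ℝ) ≤ n := n.cast_nonneg
  have hO' : ‖O‖ ≤ n + 1 := by nlinarith [norm_nonneg O]
  have hdesc := le_add_inner_gradient_add_sq hF.objective_differentiable hL0
    (hσ.norm_gradient_sub_le hL) x (x - η • O)
  rw [sub_sub_cancel_left, inner_neg_right, inner_smul_right, norm_neg, norm_smul,
    Real.norm_of_nonneg hη, mul_pow] at hdesc
  have h1 : inner ℝ g O = inner ℝ M O - inner ℝ (M - g) O := by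
    rw [inner_sub_left]; ring
  have h2 : inner ℝ (M - g) O ≤ ‖M - g‖ * (n + 1) :=
    (real_inner_le_norm _ _).trans (by gcongr)
  have h3 : ‖M‖ / (n + 1) ≤ inner ℝ M O := by
    rw [div_le_iff₀ (by positivity), mul_comm]; exact hM
  have h4 : ‖g‖ / (n + 1) ≤ ‖M‖ / (n + 1) + ‖M - g‖ := by
    have h5 : ‖g‖ ≤ ‖M‖ + ‖M - g‖ := by
      have := norm_sub_le M (M - g)
      rwa [sub_sub_cancel] at this
    calc ‖g‖ / (n + 1) ≤ (‖M‖ + ‖M - g‖) / (n + 1) := by gcongr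
      _ = ‖M‖ / (n + 1) + ‖M - g‖ / (n + 1) := add_div _ _ _
      _ ≤ ‖M‖ / (n + 1) + ‖M - g‖ := by
          gcongr
          exact div_le_self (norm_nonneg _) (by linarith)
  have h5 : ‖g‖ / (n + 1) - (n + 2) * ‖M - g‖ ≤ inner ℝ g O := by
    rw [h1]; linarith
  have h6 := mul_le_mul_of_nonneg_left h5 hη
  have h7 : L * (η ^ 2 * ‖O‖ ^ 2) ≤ L * (η ^ 2 * n) := by gcongr
  change objective D F (x - η • O) ≤ objective D F x + -(η * inner ℝ g O)
    + L * (η ^ 2 * ‖O‖ ^ 2) at hdesc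
  linarith

end Rate

theorem mainTheorem4 (n : ℕ) (L σ μ : ℝ) (hL : 0 < L) (hσ : 0 < σ) (hμ : 0 < μ) :
    ∃ K : ℝ, 0 < K ∧
      ∀ (m : ℕ) (_ : n ≤ m) (Z : Type*) [MeasurableSpace Z]
        (D : Measure Z) [IsProbabilityMeasure D] (F : Z → FrobSpace m n → ℝ) (fstar : ℝ)
        (_ : IsStochasticProblem D F)
        (_ : ∀ Y, fstar ≤ objective D F Y)
        (_ : IsSampleSmooth F L)
        (_ : HasUnbiasedBoundedVariance D F σ)
        (Ω : Type*) [mΩ : MeasurableSpace Ω] (P : Measure Ω) [IsProbabilityMeasure P]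
        (𝓕 : Filtration ℕ mΩ) (ξ : ℕ → Ω → Z) (_ : IsFreshSampling P D 𝓕 ξ)
        (x₁ : FrobSpace m n) (X M O : ℕ → Ω → FrobSpace m n)
        (_ : IsMuonMVR2Run F 𝓕 ξ (fun t => (t : ℝ) ^ (-(2 / 3) : ℝ))
          (fun t => 1 - (t : ℝ) ^ (-(2 / 3) : ℝ)) 1 x₁ X M O)
        (_ : ∀ t, 1 ≤ t → ∀ᵐ ω ∂P,
          2 * μ * (objective D F (X t ω) - fstar) ≤ ‖gradient (objective D F) (X t ω)‖ ^ 2),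
        (∀ T : ℕ, Integrable (fun ω => objective D F (X (T + 1) ω)) P) ∧
        ∃ T₀ : ℕ, ∀ T : ℕ, T₀ ≤ T →
          (∫ ω, objective D F (X (T + 1) ω) ∂P) - fstar
            ≤ K * ((Real.log T) ^ 2 / (T : ℝ) ^ (2 / 3 : ℝ)) := by
  set k : ℝ := √(2 * μ) / (4 * (n + 1)) with hk
  set V : ℝ := 6 * σ ^ 2 + 96 * L ^ 2 * n with hV
  set B : ℝ := √(2 * (n + 2) ^ 2 * V + 2 * (L * n) ^ 2) with hB
  have hk0 : 0 < k := by positivity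
  have hV0 : 0 < V := by positivity
  have hB0 : 0 < B := Real.sqrt_pos.2 (by positivity)
  have hB2 : B ^ 2 = 2 * (n + 2) ^ 2 * V + 2 * (L * n) ^ 2 := Real.sq_sqrt (by positivity)
  have hc1 : 0 < min k (1 / 4) := lt_min hk0 (by norm_num)
  have hc2 : 0 < min 1 k := lt_min one_pos hk0
  refine ⟨2 + 8 / k ^ 2 * (1 + 2 * B) ^ 2 + 48 / (min k (1 / 4) * min 1 k) * B ^ 2,
    by positivity, ?_⟩
  intro m hmn Z _ D _ F fstar hF hfstar hLs hvar Ω mΩ P _ 𝓕 ξ hξ x₁ X M O hrun hPL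
  have hcont : Continuous (objective D F) := hF.objective_differentiable.continuous
  have hXm : ∀ t, 1 ≤ t → Measurable (X t) := fun t ht =>
    (hrun.measurable_iterate t ht).1.mono (𝓕.le t) le_rfl
  have hint : ∀ t, 1 ≤ t → ∀ φ : FrobSpace m n → ℝ, Continuous φ →
      Integrable (fun ω => φ (X t ω)) P := by
    intro t ht φ hφ
    obtain ⟨R, hR⟩ := hrun.exists_norm_le hmn t ht
    obtain ⟨C, hC⟩ := (isCompact_closedBall (0 : FrobSpace m n) R).exists_bound_of_continuousOn
      hφ.continuousOn
    exact Integrable.of_bound (hφ.measurable.comp (hXm t ht)).aestronglyMeasurable C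
      (ae_of_all _ fun ω => hC _ (by simpa using hR ω))
  refine ⟨fun T => hint (T + 1) (by omega) _ hcont, ?_⟩
  have hδ1 : 0 ≤ objective D F x₁ - fstar := sub_nonneg.2 (hfstar x₁)
  set e : ℕ → Ω → ℝ := fun t ω => ‖M t ω - gradient (objective D F) (X t ω)‖ with he
  have herr := fun t ht => hrun.momentum_error_le hmn hF hLs hvar hξ t ht
  set E : ℕ → Ω → ℝ := fun t ω => (n + 2) * e t ω + L * n * (t : ℝ) ^ (-(1 / 3) : ℝ) with hE
  have hEm : ∀ t, 1 ≤ t → AEStronglyMeasurable (E t) P := fun t ht =>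
    (((herr t ht).1.const_mul _).add_const _).aestronglyMeasurable
  have hE2 : ∀ t : ℕ, 1 ≤ t → ∀ ω, E t ω ^ 2 ≤
      2 * (n + 2) ^ 2 * e t ω ^ 2 + 2 * (L * n) ^ 2 * (t : ℝ) ^ (-(2 / 3) : ℝ) := by
    intro t ht ω
    have h1 : ((t : ℝ) ^ (-(1 / 3) : ℝ)) ^ 2 = (t : ℝ) ^ (-(2 / 3) : ℝ) := by
      rw [← Real.rpow_natCast, ← Real.rpow_mul t.cast_nonneg]; norm_num
    rw [← h1]
    simp only [hE]
    nlinarith [sq_nonneg ((n + 2) * e t ω - L * n * (t : ℝ) ^ (-(1 / 3) : ℝ))]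
  have hdom : ∀ t : ℕ, 1 ≤ t → Integrable (fun ω =>
      2 * (n + 2) ^ 2 * e t ω ^ 2 + 2 * (L * n) ^ 2 * (t : ℝ) ^ (-(2 / 3) : ℝ)) P := fun t ht =>
    ((herr t ht).2.1.const_mul _).add (integrable_const _)
  have hEi : ∀ t, 1 ≤ t → Integrable (fun ω => E t ω ^ 2) P := fun t ht =>
    (hdom t ht).mono' ((hEm t ht).pow 2) (ae_of_all _ fun ω => by
      rw [Real.norm_of_nonneg (sq_nonneg _)]; exact hE2 t ht ω)
  have hEb : ∀ t : ℕ, 1 ≤ t → ∫ ω, E t ω ^ 2 ∂P ≤ B ^ 2 * (t : ℝ) ^ (-(2 / 3) : ℝ) := by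
    intro t ht
    refine (integral_mono (hEi t ht) (hdom t ht) (hE2 t ht)).trans ?_
    rw [integral_add ((herr t ht).2.1.const_mul _) (integrable_const _), integral_const_mul]
    simp only [integral_const, probReal_univ, one_smul]
    have := mul_le_mul_of_nonneg_left (herr t ht).2.2
      (by positivity : (0 : ℝ) ≤ 2 * (n + 2) ^ 2)
    rw [hB2]
    linarith
  have hstep : ∀ t : ℕ, 1 ≤ t → ∀ᵐ ω ∂P, objective D F (X (t + 1) ω) - fstar ≤
      (objective D F (X t ω) - fstar) + (t : ℝ) ^ (-(2 / 3) : ℝ) *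
        (E t ω - 4 * k * √(objective D F (X t ω) - fstar)) := by
    intro t ht
    filter_upwards [hPL t ht] with ω hω
    have hη : 0 ≤ (t : ℝ) ^ (-(2 / 3) : ℝ) := by positivity
    have h := objective_muon_step_le hmn hL.le hF hLs hvar hη (x := X t ω)
      (hrun.direction t ht ω)
    rw [hrun.iterate_succ t ht]
    have hgrad : 4 * k * √(objective D F (X t ω) - fstar) ≤
        ‖gradient (objective D F) (X t ω)‖ / (n + 1) := by
      have h1 : √(2 * μ) * √(objective D F (X t ω) - fstar) ≤
          ‖gradient (objective D F) (X t ω)‖ := by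
        rw [← Real.sqrt_mul (by positivity)]
        exact Real.sqrt_le_iff.2 ⟨norm_nonneg _, hω⟩
      calc 4 * k * √(objective D F (X t ω) - fstar)
          = √(2 * μ) * √(objective D F (X t ω) - fstar) / (n + 1) := by rw [hk]; field_simp
        _ ≤ _ := by gcongr
    have hpow : (t : ℝ) ^ (-(2 / 3) : ℝ) ≤ (t : ℝ) ^ (-(1 / 3) : ℝ) :=
      Real.rpow_le_rpow_of_exponent_le (by exact_mod_cast ht) (by norm_num)
    have hpow' : L * n * (t : ℝ) ^ (-(2 / 3) : ℝ) ≤ L * n * (t : ℝ) ^ (-(1 / 3) : ℝ) := by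
      gcongr
    have hcomb : (n + 2) * e t ω + L * n * (t : ℝ) ^ (-(2 / 3) : ℝ)
        - ‖gradient (objective D F) (X t ω)‖ / (n + 1) ≤
        E t ω - 4 * k * √(objective D F (X t ω) - fstar) := by
      simp only [hE]; linarith
    have := mul_le_mul_of_nonneg_left hcomb hη
    linarith
  obtain ⟨T₀, hT₀⟩ := sqrt_recursion_rate (P := P) (D₀ := objective D F x₁ - fstar + 1) hk0 hB0
    (by linarith) (δ := fun t ω => objective D F (X t ω) - fstar) (E := E)
    (fun t _ ω => sub_nonneg.2 (hfstar _)) (fun t _ ω => by positivity)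
    (fun t ht => (hint t ht (fun x => objective D F x - fstar) (by fun_prop)).1) hEm
    (fun t ht => hint t ht (fun x => (objective D F x - fstar) ^ 2) (by fun_prop)) hEi hEb hstep
    (by simp only [hrun.iterate_one, integral_const, probReal_univ, one_smul]; gcongr; linarith)
  refine ⟨T₀, fun T hT => ?_⟩
  have h := hT₀ T hT
  rw [integral_sub (hint (T + 1) (by omega) _ hcont) (integrable_const _)] at h
  simpa using h
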